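/- Let $k$ be a commutative ring and let $\mathcal C$ be a $k$-linear category with unit, i.e. a $k$-linear category with a fixed object $\mathbb 1$ such that $\mathrm{End}_{\mathcal C}(\mathbb 1)\simeq k$. **Notation.** For finite sets $I_1,\dots,I_l$, a *recollement* is a partition (equivalence relation) $r$ of $I_1\sqcup\dots\sqcup I_l$ such that each $I_a$ injects into the quotient; $\#r$ is its number of classes and $R(I_1,\dots,I_l)$ is the set of recollements. A recollement of $I,J$ is written as a set of pairs $(i,j),(i,\varnothing),(\varnothing,j)$, one for each class, and similarly with triples for three sets; $\pi_{a,b}$ denotes restriction to $I_a\sqcup I_b$. For finite families $U_I=(U_i)_{i\in I}$, $V_J=(V_j)_{j\in J}$ of objects of $\mathcal C$, with the convention $U_\varnothing=V_\varnothing=\mathbb 1$, put $$H_r(U_I;V_J)=\bigotimes_{(i,j)\in r}\mathrm{Hom}_{\mathcal C}(U_i,V_j),\qquad H(U_I;V_J)=\bigoplus_{r\in R(I,J)}H_r(U_I;V_J).$$ For $r\in R(I,J)$ and $s\in R(J,K)$ let $R(s\circ r)=\{u\in R(I,J,K) : \pi_{1,2}(u)=r,\ \pi_{2,3}(u)=s\}$.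 For $u\in R(s\circ r)$, $\Phi\in H_r(U_I;V_J)$ and $\Psi\in H_s(V_J;W_K)$, let $\Psi\circ_u\Phi\in H_{\pi_{1,3}(u)}(U_I;W_K)$ be obtained by composing $\mathrm{Hom}(U_i,V_j)\otimes\mathrm{Hom}(V_j,W_k)\to\mathrm{Hom}(U_i,W_k)$ for all $(i,j,k)\in u$ (using $\mathrm{id}_{\mathbb 1}$ at $(\varnothing,\varnothing)$), where a composite $\mathbb 1\to V_j\to\mathbb 1$ for $(\varnothing,j,\varnothing)\in u$ is regarded as a scalar in $k\simeq\mathrm{End}(\mathbb 1)$. Let $$P_u(T)=\prod_{\#\pi_{1,3}(u)\le a<\#u}(T-a).$$ For $d\in\mathbb N$, let $\mathcal W_d(\mathcal C)$ be the category of $\mathfrak S_d$-invariant objects and morphisms in the pseudo-abelian envelope of the $d$-fold tensor product category $\mathcal C^{\boxtimes d}$, where $\mathfrak S_d$ permutes the factors. Let $\langle U_I\rangle_d\in\mathcal W_d(\mathcal C)$ be the direct sum of the objects $U_{i_1}\boxtimes\dots\boxtimes U_{i_d}$ over all sequences $(i_1,\dots,i_d)$ in $I\sqcup\{\varnothing\}$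 in which every $i\in I$ occurs exactly once, with $\mathfrak S_d$ permuting the summands. For $\Phi\in H_r(U_I;V_J)$ let $\langle\Phi\rangle_d\colon\langle U_I\rangle_d\to\langle V_J\rangle_d$ be the morphism whose matrix entry at $U_{i_1}\boxtimes\dots\boxtimes U_{i_d}\to V_{j_1}\boxtimes\dots\boxtimes V_{j_d}$ is $\Phi$ (after reordering the factors and inserting $\mathrm{id}_{\mathbb 1}$ at each $(\varnothing,\varnothing)$) if the sequence $((i_a,j_a))_a$, after removal of all terms $(\varnothing,\varnothing)$, lists each element of $r$ exactly once, and is $0$ otherwise. **Statement.** 1. For every $d\in\mathbb N$, all $\Phi\in H_r(U_I;V_J)$ and $\Psi\in H_s(V_J;W_K)$, $$\langle\Psi\rangle_d\circ\langle\Phi\rangle_d=\sum_{u\in R(s\circ r)}P_u(d)\,\langle\Psi\circ_u\Phi\rangle_d .$$ 2. For every $t\in k$ there is a $k$-linear category with objects the symbols $\langle U_I\rangle_t$ for finite families $U_I$ of objects of $\mathcal C$, with $\mathrm{Hom}(\langle U_I\rangle_t,\langle V_J\rangle_t)=H(U_I;V_J)$, and with composition the bilinear extension of $$\langle\Psi\rangle_t\circ\langle\Phi\rangle_t=\sum_{u\in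 R(s\circ r)}P_u(t)\,\langle\Psi\circ_u\Phi\rangle_t\qquad(\Phi\in H_r(U_I;V_J),\ \Psi\in H_s(V_J;W_K)).$$ That is, this composition is associative, and $\bigotimes_{i\in I}\mathrm{id}_{U_i}\in H_{r_I}(U_I;U_I)$ with $r_I=\{(i,i) : i\in I\}$ is a two-sided identity of $\langle U_I\rangle_t$. (The category $\mathcal S_t(\mathcal C)$ is the pseudo-abelian envelope of this category.) -/

import Mathlib

universe w v u

open CategoryTheory
open scoped TensorProduct DirectSum

noncomputable section

namespace WreathCat

section Recollements

/-- A recollement of two sets `I`, `J`: a partition (equivalence relation) of `I ⊔ J`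
such that `I` and `J` inject into the quotient. -/
@[ext]
structure Rec₂ (I J : Type) where
  rel : Setoid (I ⊕ J)
  inj₁ : ∀ i i' : I, rel (.inl i) (.inl i') → i = i'
  inj₂ : ∀ j j' : J, rel (.inr j) (.inr j') → j = j'

/-- A recollement of three sets `I`, `J`, `K`. -/
@[ext]
structure Rec₃ (I J K : Type) where
  rel : Setoid (I ⊕ J ⊕ K)
  inj₁ : ∀ i i' : I, rel (.inl i) (.inl i') → i = i'
  inj₂ : ∀ j j' : J, rel (.inr (.inl j)) (.inr (.inl j')) → j = j'
  inj₃ : ∀ k k' : K, rel (.inr (.inr k)) (.inr (.inr k')) → k = k'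

variable {I J K : Type}

/-- The subset `{i, j}` of `I ⊔ J` written as `(i, j)`, where `none` stands for the extra
symbol `∅`; thus `(i, ∅)` is `{i}` and `(∅, j)` is `{j}`. -/
def block₂ (p : Option I × Option J) : Set (I ⊕ J) :=
  {e | Sum.elim (fun i => p.1 = some i) (fun j => p.2 = some j) e}

/-- The subset `{i, j, k}` of `I ⊔ J ⊔ K` written as `(i, j, k)`, with `none` for `∅`. -/
def block₃ (p : Option I × Option J × Option K) : Set (I ⊕ J ⊕ K) :=
  {e | Sum.elim (fun i => p.1 = some i)
    (Sum.elim (fun j => p.2.1 = some j) (fun k => p.2.2 = some k)) e}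

namespace Rec₂

/-- The recollement written as a set of pairs `{(i, j), …, (i', ∅), …, (∅, j'), …}`. -/
def pairs (r : Rec₂ I J) : Set (Option I × Option J) :=
  {p | block₂ p ∈ r.rel.classes}

/-- The number of equivalence classes. -/
def length (r : Rec₂ I J) : ℕ := r.rel.classes.ncard

/-- The recollement `{(i, i) | i ∈ I}` of `I` and `I`. -/
def diag (I : Type) : Rec₂ I I where
  rel := Setoid.ker (Sum.elim id id)
  inj₁ _ _ h := h
  inj₂ _ _ h := h

theorem mem_pairs (r : Rec₂ I J) (x : Option I) (y : Option J) :
    (x, y) ∈ r.pairs ↔ ∃ e, ∀ e', r.rel e' e ↔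
      Sum.elim (fun i => x = some i) (fun j => y = some j) e' := by
  simp only [pairs, Setoid.classes, Set.mem_ofPred_eq, block₂, Set.ext_iff]
  exact ⟨fun ⟨e, h⟩ => ⟨e, fun e' => (h e').symm⟩, fun ⟨e, h⟩ => ⟨e, fun e' => (h e').symm⟩⟩

theorem none_notMem (r : Rec₂ I J) : (none, none) ∉ r.pairs := fun h => by
  obtain ⟨e, he⟩ := (mem_pairs ..).1 h
  have h' := (he e).1 (r.rel.refl e)
  rcases e with i | j <;> cases h'

theorem diag_pairs (p : (diag I).pairs) : p.1.1 = p.1.2 := by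
  obtain ⟨⟨x, y⟩, hp⟩ := p
  obtain ⟨e, he⟩ := (mem_pairs _ _ _).1 hp
  have key : ∀ i : I, x = some i ↔ y = some i := fun i => by
    rw [show (x = some i) = Sum.elim (fun i => x = some i) (fun j => y = some j) (Sum.inl i)
      from rfl, ← he, show (y = some i) = Sum.elim (fun i => x = some i) (fun j => y = some j)
      (Sum.inr i) from rfl, ← he]
    rfl
  exact Option.ext key

end Rec₂

namespace Rec₃

/-- The recollement written as a set of triples `{(i, j, k), …}`. -/
def triples (u : Rec₃ I J K) : Set (Option I × Option J × Option K) :=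
  {p | block₃ p ∈ u.rel.classes}

/-- The number of equivalence classes. -/
def length (u : Rec₃ I J K) : ℕ := u.rel.classes.ncard

/-- Restriction to `I ⊔ J`. -/
def π₁₂ (u : Rec₃ I J K) : Rec₂ I J where
  rel := u.rel.comap (Sum.map id Sum.inl)
  inj₁ i i' h := u.inj₁ i i' h
  inj₂ j j' h := u.inj₂ j j' h

/-- Restriction to `J ⊔ K`. -/
def π₂₃ (u : Rec₃ I J K) : Rec₂ J K where
  rel := u.rel.comap Sum.inr
  inj₁ j j' h := u.inj₂ j j' h
  inj₂ k k' h := u.inj₃ k k' h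

/-- Restriction to `I ⊔ K`. -/
def π₁₃ (u : Rec₃ I J K) : Rec₂ I K where
  rel := u.rel.comap (Sum.map id Sum.inr)
  inj₁ i i' h := u.inj₁ i i' h
  inj₂ k k' h := u.inj₃ k k' h

instance [Finite I] [Finite J] [Finite K] : Finite (Rec₃ I J K) :=
  Finite.of_injective (fun u : Rec₃ I J K => fun a b => u.rel a b) fun u v h => by
    ext a b
    exact iff_of_eq (congrFun (congrFun h a) b)

/-- The polynomial `P_u(T) = ∏_{#π₁₃(u) ≤ a < #u} (T - a)`. -/
def poly (k : Type w) [CommRing k] (u : Rec₃ I J K) : Polynomial k :=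
  ∏ a ∈ Finset.Ico u.π₁₃.length u.length, (Polynomial.X - Polynomial.C (a : k))

theorem mem_triples (u : Rec₃ I J K) (x : Option I) (y : Option J) (z : Option K) :
    (x, y, z) ∈ u.triples ↔ ∃ e, ∀ e', u.rel e' e ↔
      Sum.elim (fun i => x = some i)
        (Sum.elim (fun j => y = some j) (fun k => z = some k)) e' := by
  simp only [triples, Setoid.classes, Set.mem_ofPred_eq, block₃, Set.ext_iff]
  exact ⟨fun ⟨e, h⟩ => ⟨e, fun e' => (h e').symm⟩, fun ⟨e, h⟩ => ⟨e, fun e' => (h e').symm⟩⟩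

/-- Every element of the glued set lies in exactly one block. -/
theorem exists_triple (u : Rec₃ I J K) (e : I ⊕ J ⊕ K) :
    ∃ x y z, (x, y, z) ∈ u.triples ∧ ∀ e', u.rel e' e ↔
      Sum.elim (fun i => x = some i)
        (Sum.elim (fun j => y = some j) (fun k => z = some k)) e' := by
  have aux : ∀ {X : Type} (f : X → I ⊕ J ⊕ K) (_ : ∀ a b, u.rel (f a) (f b) → a = b),
      ∃ x : Option X, ∀ a, u.rel (f a) e ↔ x = some a := fun {X} f hf => by
    by_cases h : ∃ a, u.rel (f a) e
    · obtain ⟨a, ha⟩ := h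
      refine ⟨some a, fun b => ⟨fun hb => ?_, fun hb => ?_⟩⟩
      · rw [hf a b (u.rel.trans ha (u.rel.symm hb))]
      · cases hb; exact ha
    · exact ⟨none, fun a => ⟨fun ha => (h ⟨a, ha⟩).elim, fun ha => by cases ha⟩⟩
  obtain ⟨x, hx⟩ := aux (fun i => .inl i) u.inj₁
  obtain ⟨y, hy⟩ := aux (fun j => .inr (.inl j)) u.inj₂
  obtain ⟨z, hz⟩ := aux (fun k => .inr (.inr k)) u.inj₃
  have key : ∀ e', u.rel e' e ↔ Sum.elim (fun i => x = some i)
        (Sum.elim (fun j => y = some j) (fun k => z = some k)) e' := by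
    rintro (i | j | k)
    exacts [hx i, hy j, hz k]
  exact ⟨x, y, z, (mem_triples ..).2 ⟨e, key⟩, key⟩

/-- Two triples of a recollement with a common element are equal. -/
theorem triple_unique (u : Rec₃ I J K) {t t' : Option I × Option J × Option K}
    (ht : t ∈ u.triples) (ht' : t' ∈ u.triples)
    (h : ∃ e, e ∈ block₃ t ∧ e ∈ block₃ t') : t = t' := by
  obtain ⟨e, he, he'⟩ := h
  have hb : block₃ t = block₃ t' := Setoid.eq_of_mem_classes ht he ht' he'
  obtain ⟨x, y, z⟩ := t
  obtain ⟨x', y', z'⟩ := t'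
  have h1 := fun i => iff_of_eq (congrArg (fun s => Sum.inl i ∈ s) hb)
  have h2 := fun i => iff_of_eq (congrArg (fun s => Sum.inr (Sum.inl i) ∈ s) hb)
  have h3 := fun i => iff_of_eq (congrArg (fun s => Sum.inr (Sum.inr i) ∈ s) hb)
  exact Prod.ext (Option.ext h1) (Prod.ext (Option.ext h2) (Option.ext h3))

/-- Each pair of `π₁₂ u` comes from exactly one triple of `u`. -/
theorem exists_unique₁₂ (u : Rec₃ I J K) (p : Option I × Option J) (hp : p ∈ u.π₁₂.pairs) :
    ∃! t : u.triples, (t.1.1, t.1.2.1) = p := by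
  obtain ⟨x, y⟩ := p
  obtain ⟨e, he⟩ := (Rec₂.mem_pairs ..).1 hp
  obtain ⟨x', y', z', ht, h⟩ := u.exists_triple (Sum.map id Sum.inl e)
  have hx : x' = x := Option.ext fun i => ((h (.inl i)).symm.trans (he (.inl i)))
  have hy : y' = y := Option.ext fun j => ((h (.inr (.inl j))).symm.trans (he (.inr j)))
  subst hx hy
  refine ⟨⟨_, ht⟩, rfl, fun t htp => Subtype.ext (u.triple_unique t.2 ht ?_)⟩
  have hee := (he e).1 (u.π₁₂.rel.refl e)
  obtain ⟨⟨x1, y1, z1⟩, h1⟩ := t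
  obtain ⟨rfl, rfl⟩ := Prod.mk.inj htp
  refine ⟨Sum.map id Sum.inl e, ?_, ?_⟩ <;> rcases e with i | j <;> exact hee

/-- Each pair of `π₂₃ u` comes from exactly one triple of `u`. -/
theorem exists_unique₂₃ (u : Rec₃ I J K) (p : Option J × Option K) (hp : p ∈ u.π₂₃.pairs) :
    ∃! t : u.triples, (t.1.2.1, t.1.2.2) = p := by
  obtain ⟨x, y⟩ := p
  obtain ⟨e, he⟩ := (Rec₂.mem_pairs ..).1 hp
  obtain ⟨x', y', z', ht, h⟩ := u.exists_triple (Sum.inr e)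
  have hx : y' = x := Option.ext fun i => ((h (.inr (.inl i))).symm.trans (he (.inl i)))
  have hy : z' = y := Option.ext fun j => ((h (.inr (.inr j))).symm.trans (he (.inr j)))
  subst hx hy
  refine ⟨⟨_, ht⟩, rfl, fun t htp => Subtype.ext (u.triple_unique t.2 ht ?_)⟩
  have hee := (he e).1 (u.π₂₃.rel.refl e)
  obtain ⟨⟨x1, y1, z1⟩, h1⟩ := t
  obtain ⟨rfl, rfl⟩ := Prod.mk.inj htp
  refine ⟨Sum.inr e, ?_, ?_⟩ <;> rcases e with i | j <;> exact hee

/-- Each pair of `π₁₃ u` comes from a triple of `u`. -/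
theorem exists_mid (u : Rec₃ I J K) (p : u.π₁₃.pairs) :
    ∃ y, (p.1.1, y, p.1.2) ∈ u.triples := by
  obtain ⟨⟨x, y⟩, hp⟩ := p
  obtain ⟨e, he⟩ := (Rec₂.mem_pairs ..).1 hp
  obtain ⟨x', y', z', ht, h⟩ := u.exists_triple (Sum.map id Sum.inr e)
  have hx : x' = x := Option.ext fun i => ((h (.inl i)).symm.trans (he (.inl i)))
  have hy : z' = y := Option.ext fun j => ((h (.inr (.inr j))).symm.trans (he (.inr j)))
  subst hx hy
  exact ⟨y', ht⟩

/-- Every triple which is not an orphan `(∅, j, ∅)` restricts to a pair of `π₁₃ u`. -/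
theorem mem_pairs₁₃ (u : Rec₃ I J K) {t : Option I × Option J × Option K}
    (ht : t ∈ u.triples) (h : ¬ (t.1 = none ∧ t.2.2 = none)) : (t.1, t.2.2) ∈ u.π₁₃.pairs := by
  obtain ⟨x, y, z⟩ := t
  obtain ⟨e, he⟩ := (mem_triples ..).1 ht
  have hex : ∃ e₀ : I ⊕ K, Sum.elim (fun i => x = some i) (fun k => z = some k) e₀ := by
    rcases x with _ | i
    · rcases z with _ | k
      · exact (h ⟨rfl, rfl⟩).elim
      · exact ⟨.inr k, rfl⟩
    · exact ⟨.inl i, rfl⟩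
  obtain ⟨e₀, h₀⟩ := hex
  have h1 : u.rel (Sum.map id Sum.inr e₀) e := (he _).2 (by rcases e₀ with i | k <;> exact h₀)
  refine (Rec₂.mem_pairs ..).2 ⟨e₀, fun e' => ?_⟩
  have h2 : u.rel (Sum.map id Sum.inr e') e ↔
      Sum.elim (fun i => x = some i) (fun k => z = some k) e' := by
    rw [he]; rcases e' with i | k <;> rfl
  rw [← h2]
  exact ⟨fun h => u.rel.trans h h1, fun h => u.rel.trans h (u.rel.symm h1)⟩

/-- The triple of `u` over a pair of `π₁₃ u`. -/
def mid (u : Rec₃ I J K) (p : u.π₁₃.pairs) : Option J := (u.exists_mid p).choose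

theorem mid_mem (u : Rec₃ I J K) (p : u.π₁₃.pairs) :
    (p.1.1, u.mid p, p.1.2) ∈ u.triples := (u.exists_mid p).choose_spec

/-- A triple over a pair of `π₁₃ u` has the middle term `mid`. -/
theorem mid_unique (u : Rec₃ I J K) (p : u.π₁₃.pairs) {t : Option I × Option J × Option K}
    (ht : t ∈ u.triples) (h : (t.1, t.2.2) = p.1) : t = (p.1.1, u.mid p, p.1.2) := by
  obtain ⟨⟨x, y⟩, hp⟩ := p
  obtain ⟨x1, y1, z1⟩ := t
  obtain ⟨rfl, rfl⟩ := Prod.mk.inj h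
  refine u.triple_unique ht (u.mid_mem _) ?_
  obtain ⟨e, he⟩ := (Rec₂.mem_pairs ..).1 hp
  have hee := (he e).1 (u.π₁₃.rel.refl e)
  refine ⟨Sum.map id Sum.inr e, ?_, ?_⟩ <;> rcases e with i | j <;> exact hee

end Rec₃

/-- The set `R(s ∘ r)` of recollements of `I`, `J`, `K` which restrict to `r` and `s`. -/
abbrev Gluing (r : Rec₂ I J) (s : Rec₂ J K) : Type :=
  {u : Rec₃ I J K // u.π₁₂ = r ∧ u.π₂₃ = s}

instance [Finite I] [Finite J] [Finite K] (r : Rec₂ I J) (s : Rec₂ J K) : Fintype (Gluing r s) :=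
  Fintype.ofFinite _

end Recollements

/-- A `k`-linear category with unit: a fixed object `𝟙` with `End 𝟙 ≃ k`. -/
class LinearWithUnit (k : Type w) [CommRing k] (C : Type u) [Category.{v} C] [Preadditive C]
    [Linear k C] where
  one : C
  endOne : End one ≃ₐ[k] k

section Homs

variable (k : Type w) [CommRing k] {C : Type u} [Category.{v} C] [Preadditive C]
  [Linear k C] [LinearWithUnit k C] {I J K : Type}

/-- The family `U` extended by `U_∅ = 𝟙`. -/
def obj (U : I → C) : Option I → C
  | none => LinearWithUnit.one k
  | some i => U i

/-- Families of morphisms `U_i ⟶ V_j` indexed by a set `S` of pairs. -/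
abbrev MorFam (U : I → C) (V : J → C) (S : Set (Option I × Option J)) (p : S) : Type v :=
  obj k U p.1.1 ⟶ obj k V p.1.2

/-- `H_r(U; V) = ⨂_{(i, j) ∈ r} Hom(U_i, V_j)`. -/
abbrev HRec (U : I → C) (V : J → C) (r : Rec₂ I J) : Type (max w v) :=
  ⨂[k] p : r.pairs, MorFam k U V r.pairs p

open Classical in
/-- `H(U; V) = ⨁_r H_r(U; V)`. -/
abbrev HTot (U : I → C) (V : J → C) : Type (max w v) :=
  ⨁ r : Rec₂ I J, HRec k U V r

open Classical in
/-- The inclusion of the summand `H_r(U; V)`. -/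
def incl (U : I → C) (V : J → C) (r : Rec₂ I J) : HRec k U V r →ₗ[k] HTot k U V :=
  DirectSum.lof k (Rec₂ I J) (fun r => HRec k U V r) r

/-- The identity of `𝟙` for the pair `(∅, ∅)`. -/
def idUnit (U : I → C) (V : J → C) : ∀ x y, obj k U x ⟶ obj k V y
  | none, none => 𝟙 (LinearWithUnit.one k)
  | _, _ => 0

open Classical in
/-- The family `φ` extended to all pairs; the term at `(∅, ∅)` is the identity of `𝟙`. -/
def fill (U : I → C) (V : J → C) (S : Set (Option I × Option J)) (φ : ∀ p, MorFam k U V S p)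
    (q : Option I × Option J) : obj k U q.1 ⟶ obj k V q.2 :=
  if h : q ∈ S then φ ⟨q, h⟩ else idUnit k U V q.1 q.2

theorem fill_update {A : Type} [DecidableEq A]
    (U : I → C) (V : J → C) (S : Set (Option I × Option J)) [DecidableEq S]
    (f : A → Option I × Option J) (φ : ∀ p, MorFam k U V S p) (a₀ : A) (h₀ : f a₀ ∈ S)
    (hu : ∀ a, f a = f a₀ → a = a₀) (v : MorFam k U V S ⟨f a₀, h₀⟩) :
    (fun a => fill k U V S (Function.update φ ⟨f a₀, h₀⟩ v) (f a)) =
      Function.update (fun a => fill k U V S φ (f a)) a₀ v := by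
  funext a
  by_cases ha : a = a₀
  · subst ha
    simp [fill, h₀]
  · have hne : f a ≠ f a₀ := fun h => ha (hu a h)
    rw [Function.update_of_ne ha]
    unfold fill
    by_cases hS : f a ∈ S
    · rw [dif_pos hS, dif_pos hS, Function.update_of_ne]
      exact fun h => hne (congrArg Subtype.val h)
    · rw [dif_neg hS, dif_neg hS]

/-- Let `f` be a list of pairs, indexed by `A`, in which each element of `S` occurs exactly once.
The tensor product over `S` is rewritten as a tensor product over `A`, with an identity of `𝟙`
inserted at each `(∅, ∅)`. -/
def spread {A : Type} (U : I → C) (V : J → C) (S : Set (Option I × Option J))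
    (f : A → Option I × Option J) (hf : ∀ p ∈ S, ∃! a, f a = p) :
    (⨂[k] p : S, MorFam k U V S p) →ₗ[k] ⨂[k] a : A, (obj k U (f a).1 ⟶ obj k V (f a).2) :=
  PiTensorProduct.lift
    { toFun φ := PiTensorProduct.tprod k fun a => fill k U V S φ (f a)
      map_update_add' := by
        classical
        rintro inst φ ⟨q, hq⟩ v v'
        obtain ⟨a₀, h₀, hu⟩ := hf q hq
        subst h₀
        rw [fill_update k U V S f φ a₀ hq hu, fill_update k U V S f φ a₀ hq hu,
          fill_update k U V S f φ a₀ hq hu]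
        exact MultilinearMap.map_update_add ..
      map_update_smul' := by
        classical
        rintro inst φ ⟨q, hq⟩ c v
        obtain ⟨a₀, h₀, hu⟩ := hf q hq
        subst h₀
        rw [fill_update k U V S f φ a₀ hq hu, fill_update k U V S f φ a₀ hq hu]
        exact MultilinearMap.map_update_smul .. }

theorem spread_tprod {A : Type} (U : I → C) (V : J → C) (S : Set (Option I × Option J))
    (f : A → Option I × Option J) (hf : ∀ p ∈ S, ∃! a, f a = p) (φ : ∀ p, MorFam k U V S p) :
    spread k U V S f hf (PiTensorProduct.tprod k φ) =
      PiTensorProduct.tprod k fun a => fill k U V S φ (f a) :=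
  PiTensorProduct.lift.tprod _

/-- A morphism `𝟙 ⟶ 𝟙` regarded as a scalar (only used for the pair `(∅, ∅)`). -/
def scalar (U : I → C) (V : J → C) : ∀ x y, (obj k U x ⟶ obj k V y) →ₗ[k] k
  | none, none => (LinearWithUnit.endOne (k := k) (C := C)).toLinearMap
  | _, _ => 0

open Classical in
/-- The term of the triple `t` in `orphanScalar`. -/
def orphanTerm (U : I → C) (W : K → C) (t : Option I × Option J × Option K)
    (m : obj k U t.1 ⟶ obj k W t.2.2) : k :=
  if t.1 = none ∧ t.2.2 = none then scalar k U W t.1 t.2.2 m else 1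

/-- The product, over the orphans `(∅, j, ∅)` of `u`, of the scalars given by `c`. -/
def orphanScalar (U : I → C) (W : K → C) (u : Rec₃ I J K)
    (c : ∀ t : u.triples, obj k U t.1.1 ⟶ obj k W t.1.2.2) : k :=
  ∏ᶠ t : u.triples, orphanTerm k U W t.1 (c t)

theorem orphanScalar_update [Finite I] [Finite J] [Finite K] (U : I → C) (W : K → C)
    (u : Rec₃ I J K) [DecidableEq u.triples]
    (c : ∀ t : u.triples, obj k U t.1.1 ⟶ obj k W t.1.2.2) (t : u.triples)
    (m : obj k U t.1.1 ⟶ obj k W t.1.2.2) :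
    orphanScalar k U W u (Function.update c t m) =
      orphanTerm k U W t.1 m * ∏ᶠ t' : {t' // t' ≠ t}, orphanTerm k U W t'.1.1 (c t'.1) := by
  classical
  have := Fintype.ofFinite u.triples
  rw [orphanScalar, finprod_eq_prod_of_fintype, Fintype.prod_eq_mul_prod_subtype_ne _ t,
    Function.update_self, finprod_eq_prod_of_fintype]
  congr 1
  exact Finset.prod_congr rfl fun t' _ => by rw [Function.update_of_ne t'.2]

/-- The family indexed by the pairs of `π₁₃ u` obtained by dropping the orphans. -/
def dropOrphans (U : I → C) (W : K → C) (u : Rec₃ I J K)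
    (c : ∀ t : u.triples, obj k U t.1.1 ⟶ obj k W t.1.2.2) (p : u.π₁₃.pairs) :
    MorFam k U W u.π₁₃.pairs p :=
  c ⟨(p.1.1, u.mid p, p.1.2), u.mid_mem p⟩

theorem dropOrphans_update_orphan (U : I → C) (W : K → C)
    (u : Rec₃ I J K) [DecidableEq u.triples]
    (c : ∀ t : u.triples, obj k U t.1.1 ⟶ obj k W t.1.2.2) (t : u.triples)
    (m : obj k U t.1.1 ⟶ obj k W t.1.2.2) (ht : t.1.1 = none ∧ t.1.2.2 = none) :
    dropOrphans k U W u (Function.update c t m) = dropOrphans k U W u c := by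
  funext p
  refine Function.update_of_ne (fun h => ?_) _ _
  subst h
  obtain ⟨⟨x, y⟩, hp⟩ := p
  obtain ⟨rfl, rfl⟩ : x = none ∧ y = none := ht
  exact Rec₂.none_notMem _ hp

theorem dropOrphans_update (U : I → C) (W : K → C)
    (u : Rec₃ I J K) [DecidableEq u.triples] [DecidableEq u.π₁₃.pairs]
    (c : ∀ t : u.triples, obj k U t.1.1 ⟶ obj k W t.1.2.2) (p : u.π₁₃.pairs)
    (m : MorFam k U W u.π₁₃.pairs p) :
    dropOrphans k U W u (Function.update c ⟨(p.1.1, u.mid p, p.1.2), u.mid_mem p⟩ m) =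
      Function.update (dropOrphans k U W u c) p m := by
  funext q
  by_cases h : q = p
  · subst h
    simp [dropOrphans]
  · rw [Function.update_of_ne h]
    refine Function.update_of_ne (fun h' => h ?_) _ _
    have h1 := congrArg (fun t : u.triples => (t.1.1, t.1.2.2)) h'
    exact Subtype.ext h1

/-- The tensor product over the triples of `u` of morphisms `U_i ⟶ W_k` is rewritten
as a tensor product over the pairs of `π₁₃ u`, by regarding the terms at orphans as scalars. -/
def contract [Finite I] [Finite J] [Finite K] (U : I → C) (W : K → C) (u : Rec₃ I J K) :
    (⨂[k] t : u.triples, (obj k U t.1.1 ⟶ obj k W t.1.2.2)) →ₗ[k] HRec k U W u.π₁₃ :=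
  PiTensorProduct.lift
    { toFun c := orphanScalar k U W u c • PiTensorProduct.tprod k (dropOrphans k U W u c)
      map_update_add' := by
        intro inst c t m m'
        have : DecidableEq u.π₁₃.pairs := Classical.decEq _
        simp only [orphanScalar_update]
        by_cases ht : t.1.1 = none ∧ t.1.2.2 = none
        · rw [dropOrphans_update_orphan k U W u c t (m + m') ht,
            dropOrphans_update_orphan k U W u c t m ht, dropOrphans_update_orphan k U W u c t m' ht]
          simp only [orphanTerm, if_pos ht, map_add, add_mul, add_smul]
        · obtain ⟨p, rfl⟩ : ∃ p : u.π₁₃.pairs, t = ⟨(p.1.1, u.mid p, p.1.2), u.mid_mem p⟩ :=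
            ⟨⟨_, u.mem_pairs₁₃ t.2 ht⟩, Subtype.ext (u.mid_unique _ t.2 rfl)⟩
          simp only [dropOrphans_update, orphanTerm, if_neg ht, MultilinearMap.map_update_add,
            smul_add]
      map_update_smul' := by
        intro inst c t a m
        have : DecidableEq u.π₁₃.pairs := Classical.decEq _
        simp only [orphanScalar_update]
        by_cases ht : t.1.1 = none ∧ t.1.2.2 = none
        · rw [dropOrphans_update_orphan k U W u c t (a • m) ht,
            dropOrphans_update_orphan k U W u c t m ht]
          simp only [orphanTerm, if_pos ht, map_smul, smul_eq_mul, mul_smul]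
        · obtain ⟨p, rfl⟩ : ∃ p : u.π₁₃.pairs, t = ⟨(p.1.1, u.mid p, p.1.2), u.mid_mem p⟩ :=
            ⟨⟨_, u.mem_pairs₁₃ t.2 ht⟩, Subtype.ext (u.mid_unique _ t.2 rfl)⟩
          simp only [dropOrphans_update, orphanTerm, if_neg ht, MultilinearMap.map_update_smul]
          rw [smul_comm] }

theorem contract_tprod [Finite I] [Finite J] [Finite K] (U : I → C) (W : K → C) (u : Rec₃ I J K)
    (c : ∀ t : u.triples, obj k U t.1.1 ⟶ obj k W t.1.2.2) :
    contract k U W u (PiTensorProduct.tprod k c) =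
      orphanScalar k U W u c • PiTensorProduct.tprod k (dropOrphans k U W u c) :=
  PiTensorProduct.lift.tprod _

/-- `Ψ ∘_u Φ` for `u ∈ R(s ∘ r)`, `Φ ∈ H_r(U; V)`, `Ψ ∈ H_s(V; W)`. -/
def compGlue [Finite I] [Finite J] [Finite K] (U : I → C) (V : J → C) (W : K → C) {r : Rec₂ I J} {s : Rec₂ J K}
    (u : Gluing r s) : HRec k U V r →ₗ[k] HRec k V W s →ₗ[k] HRec k U W u.1.π₁₃ :=
  ((PiTensorProduct.map₂ (R := k) fun t : u.1.triples =>
      Linear.comp (S := k) (obj k U t.1.1) (obj k V t.1.2.1) (obj k W t.1.2.2)).compl₁₂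
    (spread k U V r.pairs (fun t : u.1.triples => (t.1.1, t.1.2.1))
      fun p hp => u.1.exists_unique₁₂ p (by rw [u.2.1]; exact hp))
    (spread k V W s.pairs (fun t : u.1.triples => (t.1.2.1, t.1.2.2))
      fun p hp => u.1.exists_unique₂₃ p (by rw [u.2.2]; exact hp))).compr₂ (contract k U W u.1)

/-- On pure tensors, `Ψ ∘_u Φ` composes the terms of `Φ` and `Ψ` along each triple of `u`. -/
theorem compGlue_tprod [Finite I] [Finite J] [Finite K] (U : I → C) (V : J → C) (W : K → C)
    {r : Rec₂ I J} {s : Rec₂ J K} (u : Gluing r s) (φ : ∀ p, MorFam k U V r.pairs p)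
    (ψ : ∀ p, MorFam k V W s.pairs p) :
    compGlue k U V W u (PiTensorProduct.tprod k φ) (PiTensorProduct.tprod k ψ) =
      contract k U W u.1 (PiTensorProduct.tprod k fun t =>
        fill k U V r.pairs φ (t.1.1, t.1.2.1) ≫ fill k V W s.pairs ψ (t.1.2.1, t.1.2.2)) := by
  simp only [compGlue, LinearMap.compr₂_apply, LinearMap.compl₁₂_apply, spread_tprod,
    PiTensorProduct.map₂_tprod_tprod]
  rfl

/-- The identity `⨂_i id_{U_i}` in the summand of `{(i, i) | i ∈ I}`. -/
def idTot (U : I → C) : HTot k U U :=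
  incl k U U (Rec₂.diag I) (PiTensorProduct.tprod k fun p =>
    eqToHom (congrArg (obj k U) (Rec₂.diag_pairs p)))

/-- `∑_{u ∈ R(s ∘ r)} P_u(t) (Ψ ∘_u Φ)` for `Φ ∈ H_r(U; V)`, `Ψ ∈ H_s(V; W)`. -/
def compRec [Finite I] [Finite J] [Finite K] (t : k) (U : I → C) (V : J → C) (W : K → C)
    (r : Rec₂ I J) (s : Rec₂ J K) : HRec k U V r →ₗ[k] HRec k V W s →ₗ[k] HTot k U W :=
  ∑ u : Gluing r s, (u.1.poly k).eval t • (compGlue k U V W u).compr₂ (incl k U W u.1.π₁₃)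

open Classical in
/-- The bilinear extension of `compRec` to `H(U; V)` and `H(V; W)`. -/
def compTot [Finite I] [Finite J] [Finite K] (t : k) (U : I → C) (V : J → C) (W : K → C) :
    HTot k U V →ₗ[k] HTot k V W →ₗ[k] HTot k U W :=
  DirectSum.toModule k _ _ fun r =>
    (DirectSum.toModule k _ _ fun s => (compRec k t U V W r s).flip).flip

theorem compTot_incl [Finite I] [Finite J] [Finite K] (t : k) (U : I → C) (V : J → C) (W : K → C)
    (r : Rec₂ I J) (s : Rec₂ J K) (Φ : HRec k U V r) (Ψ : HRec k V W s) :
    compTot k t U V W (incl k U V r Φ) (incl k V W s Ψ) =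
      ∑ u : Gluing r s, (u.1.poly k).eval t •
        incl k U W u.1.π₁₃ (compGlue k U V W u Φ Ψ) := by
  simp [compTot, incl, compRec]

end Homs

/-- The objects `⟨U_I⟩` of the category whose pseudo-abelian envelope is `S_t(C)`:
finite families of objects of `C`. -/
structure S₀ (k : Type w) [CommRing k] (C : Type u) (t : k) where
  ι : Type
  [finite : Finite ι]
  obj : ι → C

attribute [instance] S₀.finite

/-- Morphisms `⟨U_I⟩ ⟶ ⟨V_J⟩` are elements of `H(U; V)`. -/
instance (k : Type w) [CommRing k] (C : Type u) [Category.{v} C] [Preadditive C]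
    [Linear k C] [LinearWithUnit k C] (t : k) : CategoryStruct.{max w v} (S₀ k C t) where
  Hom X Y := HTot k X.obj Y.obj
  id X := idTot k X.obj
  comp {X Y Z} Φ Ψ := compTot k t X.obj Y.obj Z.obj Φ Ψ

section Envelopes

variable {k : Type w} [CommRing k] {C : Type u} [Category.{v} C] [Preadditive C] [Linear k C]

/-- The entrywise `k`-linear structure on the additive envelope. -/
instance matLinear : Linear k (Mat_ C) where
  homModule X Y := inferInstanceAs (Module k (∀ i j, X.X i ⟶ Y.X j))
  smul_comp X Y Z a f g := by
    ext i j
    change ∑ l, (a • f i l) ≫ g l j = a • ∑ l, f i l ≫ g l j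
    simp [Finset.smul_sum]
  comp_smul X Y Z f a g := by
    ext i j
    change ∑ l, f i l ≫ (a • g l j) = a • ∑ l, f i l ≫ g l j
    simp [Finset.smul_sum]

instance karoubiModule (P Q : Idempotents.Karoubi C) : Module k (P ⟶ Q) where
  smul a f := ⟨a • f.f, by simp⟩
  one_smul f := by ext; exact one_smul k f.f
  mul_smul a b f := by ext; exact mul_smul a b f.f
  smul_zero a := by ext; exact smul_zero a
  smul_add a f g := by ext; exact smul_add a f.f g.f
  add_smul a b f := by ext; exact add_smul a b f.f
  zero_smul f := by ext; exact zero_smul k f.f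

@[simp] theorem karoubi_smul_f {P Q : Idempotents.Karoubi C} (a : k) (f : P ⟶ Q) :
    (a • f).f = a • f.f := rfl

instance karoubiLinear : Linear k (Idempotents.Karoubi C) where
  homModule P Q := inferInstance
  smul_comp P Q R a f g := by ext; simp
  comp_smul P Q R f a g := by ext; simp

/-- The pseudo-abelian envelope: the Karoubian envelope of the additive envelope. -/
abbrev Ps (C : Type u) [Category.{v} C] [Preadditive C] : Type _ :=
  Idempotents.Karoubi (Mat_ C)

variable {D : Type u} [Category.{v} D] [Preadditive D] [Linear k D]

/-- The extension of a functor to Karoubian envelopes. -/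
def karMap {C D : Type*} [Category* C] [Category* D] (F : C ⥤ D) :
    Idempotents.Karoubi C ⥤ Idempotents.Karoubi D where
  obj P := ⟨F.obj P.X, F.map P.p, by rw [← F.map_comp, P.idem]⟩
  map f := ⟨F.map f.f, by simp only [← F.map_comp, f.comm]⟩
  map_id P := rfl
  map_comp f g := by ext; exact F.map_comp _ _

/-- The extension of an additive functor to pseudo-abelian envelopes. -/
def psMap (F : C ⥤ D) [F.Additive] : Ps C ⥤ Ps D := karMap F.mapMat_

instance (F : C ⥤ D) [F.Additive] : (psMap F).Additive where
  map_add {P Q} f g := by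
    apply Idempotents.Karoubi.hom_ext
    apply Mat_.hom_ext
    intro i j
    exact F.map_add

instance (F : C ⥤ D) [F.Additive] [F.Linear k] : (psMap F).Linear k where
  map_smul {P Q} f a := by
    apply Idempotents.Karoubi.hom_ext
    apply Mat_.hom_ext
    intro i j
    exact F.map_smul a _

theorem psMap_comp {E : Type u} [Category.{v} E] [Preadditive E] (F : C ⥤ D) (G : D ⥤ E)
    (H : C ⥤ E) [F.Additive] [G.Additive] [H.Additive] (h : F ⋙ G = H) :
    psMap F ⋙ psMap G = psMap H := by
  subst h
  rfl

theorem psMap_id (F : C ⥤ C) [F.Additive] (h : 𝟭 C = F) : 𝟭 (Ps C) = psMap F := by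
  subst h
  rfl

end Envelopes

section Actions

/-- An action of a group `G` on a `k`-linear category by `k`-linear endofunctors `U ↦ g · U`. -/
structure CatAction (k : Type w) [CommRing k] (G : Type) [Group G] (C : Type u) [Category.{v} C]
    [Preadditive C] [Linear k C] where
  F : G → C ⥤ C
  additive : ∀ g, (F g).Additive
  linear : ∀ g, (F g).Linear k
  μ : ∀ g h, F h ⋙ F g ≅ F (g * h)
  ι : 𝟭 C ≅ F 1
  assoc : ∀ (g h l : G) (U : C),
    (F g).map ((μ h l).hom.app U) ≫ (μ g (h * l)).hom.app U =
      (μ g h).hom.app ((F l).obj U) ≫ (μ (g * h) l).hom.app U ≫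
        eqToHom (by rw [mul_assoc])
  right_unit : ∀ (g : G) (U : C),
    (F g).map (ι.hom.app U) ≫ (μ g 1).hom.app U = eqToHom (by rw [mul_one, Functor.id_obj])
  left_unit : ∀ (g : G) (U : C),
    ι.hom.app ((F g).obj U) ≫ (μ 1 g).hom.app U = eqToHom (by rw [one_mul, Functor.id_obj])

attribute [instance] CatAction.additive CatAction.linear

variable {k : Type w} [CommRing k] {G : Type} [Group G] {C : Type u} [Category.{v} C]
    [Preadditive C] [Linear k C]

/-- A `G`-invariant object: an object `U` with isomorphisms `κ g : g · U ≅ U`. -/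
structure Invariant (A : CatAction k G C) where
  X : C
  κ : ∀ g, (A.F g).obj X ≅ X
  κ_mul : ∀ g h, (A.F g).map (κ h).hom ≫ (κ g).hom = (A.μ g h).hom.app X ≫ (κ (g * h)).hom
  κ_one : A.ι.hom.app X ≫ (κ 1).hom = 𝟙 X

namespace Invariant

variable {A : CatAction k G C}

/-- The submodule of `G`-invariant morphisms. -/
def invariants (X Y : Invariant A) : Submodule k (X.X ⟶ Y.X) where
  carrier := {φ | ∀ g, (X.κ g).hom ≫ φ = (A.F g).map φ ≫ (Y.κ g).hom}
  add_mem' {φ ψ} hφ hψ g := by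
    rw [Preadditive.comp_add, hφ g, hψ g, Functor.map_add, Preadditive.add_comp]
  zero_mem' g := by simp
  smul_mem' a φ hφ g := by
    rw [Linear.comp_smul, hφ g, Functor.map_smul, Linear.smul_comp]

/-- The category `C^G` of `G`-invariant objects and morphisms. -/
instance : Category (Invariant A) where
  Hom X Y := invariants X Y
  id X := ⟨𝟙 X.X, fun g => by simp⟩
  comp f g := ⟨f.1 ≫ g.1, fun l => by
    rw [← Category.assoc, f.2 l, Category.assoc, g.2 l, Functor.map_comp, Category.assoc]⟩
  id_comp f := Subtype.ext (Category.id_comp _)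
  comp_id f := Subtype.ext (Category.comp_id _)
  assoc f g h := Subtype.ext (Category.assoc _ _ _)

instance : Preadditive (Invariant A) where
  homGroup X Y := inferInstanceAs (AddCommGroup (invariants X Y))
  add_comp _ _ _ _ _ _ := Subtype.ext (Preadditive.add_comp _ _ _ _ _ _)
  comp_add _ _ _ _ _ _ := Subtype.ext (Preadditive.comp_add _ _ _ _ _ _)

instance : Linear k (Invariant A) where
  homModule X Y := inferInstanceAs (Module k (invariants X Y))
  smul_comp _ _ _ _ _ _ := Subtype.ext (Linear.smul_comp _ _ _ _ _ _)
  comp_smul _ _ _ _ _ _ := Subtype.ext (Linear.comp_smul _ _ _ _ _ _)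

end Invariant

end Actions

section TensorPower

/-- Objects `U_1 ⊠ ⋯ ⊠ U_d` of the `d`-fold tensor product category of `C`. -/
structure TPow (k : Type w) (C : Type u) (d : ℕ) where
  obj : Fin d → C

variable {k : Type w} [CommRing k] {C : Type u} [Category.{v} C] [Preadditive C] [Linear k C]
  {d : ℕ}

namespace TPow

/-- Morphisms are `⨂_a Hom(U_a, V_a)`, composed factorwise. -/
instance : CategoryStruct.{max w v} (TPow k C d) where
  Hom U V := ⨂[k] a : Fin d, (U.obj a ⟶ V.obj a)
  id U := PiTensorProduct.tprod k fun a => 𝟙 (U.obj a)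
  comp {U V W} f g := PiTensorProduct.map₂ (R := k)
    (fun a => Linear.comp (S := k) (U.obj a) (V.obj a) (W.obj a)) f g

instance (U V : TPow k C d) : AddCommGroup (U ⟶ V) :=
  inferInstanceAs (AddCommGroup (⨂[k] a : Fin d, (U.obj a ⟶ V.obj a)))

instance (U V : TPow k C d) : Module k (U ⟶ V) :=
  inferInstanceAs (Module k (⨂[k] a : Fin d, (U.obj a ⟶ V.obj a)))

/-- The external tensor product of morphisms. -/
def tmor {U V : TPow k C d} (f : ∀ a, U.obj a ⟶ V.obj a) : U ⟶ V :=
  PiTensorProduct.tprod k f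

theorem tmor_induction {U V : TPow k C d} {P : (U ⟶ V) → Prop}
    (h : ∀ (c : k) f, P (c • tmor f)) (hadd : ∀ f g, P f → P g → P (f + g)) (f : U ⟶ V) : P f :=
  PiTensorProduct.induction_on f h hadd

/-- Composition as a bilinear map. -/
def compL (U V W : TPow k C d) : (U ⟶ V) →ₗ[k] (V ⟶ W) →ₗ[k] (U ⟶ W) :=
  PiTensorProduct.map₂ (R := k)
    (fun a => Linear.comp (S := k) (U.obj a) (V.obj a) (W.obj a))

theorem tmor_comp {U V W : TPow k C d} (f : ∀ a, U.obj a ⟶ V.obj a)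
    (g : ∀ a, V.obj a ⟶ W.obj a) :
    compL U V W (tmor f) (tmor g) = tmor fun a => f a ≫ g a :=
  PiTensorProduct.map₂_tprod_tprod _ _ _

instance : Category.{max w v} (TPow k C d) where
  id_comp {U V} f := by
    change compL U U V (tmor fun a => 𝟙 (U.obj a)) f = f
    induction f using tmor_induction with
    | h c f => simp [tmor_comp]
    | hadd f g hf hg => simp [hf, hg]
  comp_id {U V} f := by
    change compL U V V f (tmor fun a => 𝟙 (V.obj a)) = f
    induction f using tmor_induction with
    | h c f => simp [tmor_comp]
    | hadd f g hf hg => simp [hf, hg]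
  assoc {U V W X} f g h := by
    change compL U W X (compL U V W f g) h = compL U V X f (compL V W X g h)
    induction f using tmor_induction with
    | hadd f f' hf hf' => simp [hf, hf']
    | h c f =>
      induction g using tmor_induction with
      | hadd g g' hg hg' => simp only [map_add, LinearMap.add_apply, hg, hg']
      | h c' g =>
        induction h using tmor_induction with
        | hadd h h' hh hh' => simp only [map_add, hh, hh']
        | h c'' h => simp [tmor_comp]

@[simp] theorem tmor_comp_tmor {U V W : TPow k C d} (f : ∀ a, U.obj a ⟶ V.obj a)
    (g : ∀ a, V.obj a ⟶ W.obj a) : tmor f ≫ tmor g = tmor fun a => f a ≫ g a :=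
  tmor_comp f g

instance : Preadditive (TPow k C d) where
  homGroup U V := inferInstance
  add_comp U V W f f' g := by
    change compL U V W (f + f') g = compL U V W f g + compL U V W f' g
    simp
  comp_add U V W f g g' := (compL U V W f).map_add g g'

instance : Linear k (TPow k C d) where
  homModule U V := inferInstance
  smul_comp U V W a f g := by
    change compL U V W (a • f) g = a • compL U V W f g
    simp
  comp_smul U V W f a g := (compL U V W f).map_smul a g

/-- The action of a permutation on morphisms. -/
def permHom (g : Equiv.Perm (Fin d)) (U V : TPow k C d) :
    (U ⟶ V) →ₗ[k] ((⟨fun a => U.obj (g.symm a)⟩ : TPow k C d) ⟶ ⟨fun a => V.obj (g.symm a)⟩) :=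
  (PiTensorProduct.reindex k (fun a => (U.obj a ⟶ V.obj a)) g).toLinearMap

@[simp] theorem permHom_tmor (g : Equiv.Perm (Fin d)) {U V : TPow k C d}
    (f : ∀ a, U.obj a ⟶ V.obj a) : permHom g U V (tmor f) = tmor fun a => f (g.symm a) :=
  PiTensorProduct.reindex_tprod _ _

/-- The functor `U_1 ⊠ ⋯ ⊠ U_d ↦ U_{g⁻¹(1)} ⊠ ⋯ ⊠ U_{g⁻¹(d)}`. -/
def perm (g : Equiv.Perm (Fin d)) : TPow k C d ⥤ TPow k C d where
  obj U := ⟨fun a => U.obj (g.symm a)⟩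
  map {U V} f := permHom g U V f
  map_id U := permHom_tmor g _
  map_comp {U V W} f f' := by
    induction f using tmor_induction with
    | hadd f g hf hg => simp only [Preadditive.add_comp, map_add, hf, hg]
    | h c f =>
      induction f' using tmor_induction with
      | hadd f g hf hg => simp only [Preadditive.comp_add, map_add, hf, hg]
      | h c' f' => simp

instance (g : Equiv.Perm (Fin d)) : (perm (k := k) (C := C) g).Additive where
  map_add {U V} f f' := (permHom g U V).map_add f f'

instance (g : Equiv.Perm (Fin d)) : (perm (k := k) (C := C) g).Linear k where
  map_smul {U V} f a := (permHom g U V).map_smul a f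

theorem perm_comp (g h : Equiv.Perm (Fin d)) :
    perm (k := k) (C := C) h ⋙ perm g = perm (g * h) := by
  refine CategoryTheory.Functor.hext (fun _ => rfl) fun U V f => heq_of_eq ?_
  change permHom g _ _ (permHom h _ _ f) = permHom (g * h) _ _ f
  induction f using tmor_induction with
  | hadd f g hf hg => simp only [map_add, hf, hg]; rfl
  | h c f => simp only [map_smul, permHom_tmor]; rfl

theorem perm_one : 𝟭 (TPow k C d) = perm 1 := by
  refine CategoryTheory.Functor.hext (fun _ => rfl) fun U V f => heq_of_eq ?_
  change f = permHom 1 _ _ f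
  induction f using tmor_induction with
  | hadd f g hf hg => rw [map_add, ← hf, ← hg]; rfl
  | h c f => simp only [map_smul, permHom_tmor]; rfl

end TPow

/-- The action of the symmetric group on the `d`-fold tensor product of pseudo-abelian
categories, by permutation of the factors. -/
def permAction (k : Type w) [CommRing k] (C : Type u) [Category.{v} C] [Preadditive C]
    [Linear k C] (d : ℕ) : CatAction k (Equiv.Perm (Fin d)) (Ps (TPow k C d)) where
  F g := psMap (TPow.perm g)
  additive g := inferInstance
  linear g := inferInstance
  μ g h := eqToIso (psMap_comp _ _ _ (TPow.perm_comp g h))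
  ι := eqToIso (psMap_id _ TPow.perm_one)
  assoc g h l U := by simp [eqToHom_app, eqToHom_map]
  right_unit g U := by simp [eqToHom_app, eqToHom_map]
  left_unit g U := by simp [eqToHom_app]

/-- The category `W_d(C)` of invariants of the symmetric group in the `d`-fold tensor product. -/
abbrev Wd (k : Type w) [CommRing k] (C : Type u) [Category.{v} C] [Preadditive C]
    [Linear k C] (d : ℕ) := Invariant (permAction k C d)

end TensorPower

section Bracket

section MatIso

variable {C : Type u} [Category.{v} C] [Preadditive C] {L M N : Mat_ C}

open Classical in
/-- The permutation matrix of a bijection of index sets which preserves the summands. -/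
def matHom (e : M.ι ≃ N.ι) (he : ∀ i, M.X i = N.X (e i)) : M ⟶ N :=
  fun i j => if h : e i = j then eqToHom ((he i).trans (congrArg N.X h)) else 0

theorem matHom_self (e : M.ι ≃ N.ι) (he : ∀ i, M.X i = N.X (e i)) (i : M.ι) :
    matHom e he i (e i) = eqToHom (he i) := dif_pos rfl

theorem matHom_ne (e : M.ι ≃ N.ι) (he : ∀ i, M.X i = N.X (e i)) {i : M.ι} {j : N.ι}
    (h : e i ≠ j) : matHom e he i j = 0 := dif_neg h

theorem matHom_comp (e : M.ι ≃ N.ι) (he : ∀ i, M.X i = N.X (e i)) (φ : N ⟶ L) (i : M.ι)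
    (l : L.ι) : (matHom e he ≫ φ) i l = eqToHom (he i) ≫ φ (e i) l := by
  rw [Mat_.comp_apply, Finset.sum_eq_single (e i), matHom_self]
  · intro j _ hj
    rw [matHom_ne e he hj.symm, Limits.zero_comp]
  · intro h
    exact (h (Finset.mem_univ _)).elim

theorem comp_matHom (e : M.ι ≃ N.ι) (he : ∀ i, M.X i = N.X (e i)) (φ : L ⟶ M) (l : L.ι)
    (i : M.ι) : (φ ≫ matHom e he) l (e i) = φ l i ≫ eqToHom (he i) := by
  rw [Mat_.comp_apply, Finset.sum_eq_single i, matHom_self]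
  · intro j _ hj
    rw [matHom_ne e he (fun h => hj (e.injective h)), Limits.comp_zero]
  · intro h
    exact (h (Finset.mem_univ _)).elim

theorem matHom_matHom (e : L.ι ≃ M.ι) (he : ∀ i, L.X i = M.X (e i)) (e' : M.ι ≃ N.ι)
    (he' : ∀ i, M.X i = N.X (e' i)) :
    matHom e he ≫ matHom e' he' = matHom (e.trans e') fun i => (he i).trans (he' (e i)) := by
  apply Mat_.hom_ext
  intro i j
  rw [matHom_comp]
  by_cases h : e' (e i) = j
  · subst h
    rw [matHom_self, eqToHom_trans]
    exact (matHom_self (e.trans e') _ i).symm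
  · rw [matHom_ne _ _ h, Limits.comp_zero]
    exact (matHom_ne (e.trans e') _ h).symm

theorem matHom_id (e : M.ι ≃ M.ι) (he : ∀ i, M.X i = M.X (e i)) (h : e = Equiv.refl _) :
    matHom e he = 𝟙 M := by
  subst h
  apply Mat_.hom_ext
  intro i j
  by_cases h : i = j
  · subst h
    rw [Mat_.id_apply_self]
    exact matHom_self (Equiv.refl _) he i
  · rw [Mat_.id_apply_of_ne _ _ _ h]
    exact matHom_ne (Equiv.refl _) he h

theorem mapMat_matHom {D : Type u} [Category.{v} D] [Preadditive D] (F : C ⥤ D) [F.Additive]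
    (e : M.ι ≃ N.ι) (he : ∀ i, M.X i = N.X (e i)) :
    F.mapMat_.map (matHom e he) =
      matHom (M := F.mapMat_.obj M) (N := F.mapMat_.obj N) e
        fun i => congrArg F.obj (he i) := by
  apply Mat_.hom_ext
  intro i j
  change F.map (matHom (M := M) (N := N) e he i j) = _
  by_cases h : e i = j
  · subst h
    refine (congrArg F.map (matHom_self e he i)).trans ?_
    rw [eqToHom_map]
    exact (matHom_self (M := F.mapMat_.obj M) (N := F.mapMat_.obj N) e _ i).symm
  · refine (congrArg F.map (matHom_ne e he h)).trans ?_
    rw [CategoryTheory.Functor.map_zero]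
    exact (matHom_ne (M := F.mapMat_.obj M) (N := F.mapMat_.obj N) e _ h).symm

/-- The isomorphism of direct sums given by a bijection of the index sets. -/
def matIso (e : M.ι ≃ N.ι) (he : ∀ i, M.X i = N.X (e i)) : M ≅ N where
  hom := matHom e he
  inv := matHom e.symm fun j => by rw [he, e.apply_symm_apply]
  hom_inv_id := by
    apply Mat_.hom_ext
    intro i i'
    rw [matHom_comp]
    by_cases h : i = i'
    · subst h
      rw [Mat_.id_apply_self, matHom, dif_pos (e.symm_apply_apply i), eqToHom_trans, eqToHom_refl]
    · rw [Mat_.id_apply_of_ne _ _ _ h, matHom_ne, Limits.comp_zero]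
      simpa using h
  inv_hom_id := by
    apply Mat_.hom_ext
    intro j j'
    rw [matHom_comp]
    by_cases h : j = j'
    · subst h
      rw [Mat_.id_apply_self, matHom, dif_pos (e.apply_symm_apply j), eqToHom_trans, eqToHom_refl]
    · rw [Mat_.id_apply_of_ne _ _ _ h, matHom_ne, Limits.comp_zero]
      simpa using h

end MatIso

section PermAction

variable {k : Type w} [CommRing k] {C : Type u} [Category.{v} C] [Preadditive C]
  [Linear k C] {d : ℕ}

/-- In the action of the symmetric group, `g · (h · U)` and `gh · U` are identified. -/
theorem permAction_μ_f (g h : Equiv.Perm (Fin d)) (M : Mat_ (TPow k C d)) :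
    (((permAction k C d).μ g h).hom.app ((Idempotents.toKaroubi _).obj M)).f =
      𝟙 ((TPow.perm g).mapMat_.obj ((TPow.perm h).mapMat_.obj M)) := by
  change ((eqToIso (psMap_comp _ _ _ (TPow.perm_comp g h))).hom.app _).f = _
  rw [eqToIso.hom, eqToHom_app, Idempotents.Karoubi.eqToHom_f]
  change (TPow.perm g).mapMat_.map ((TPow.perm h).mapMat_.map (𝟙 M)) ≫ 𝟙 _ = _
  rw [CategoryTheory.Functor.map_id, CategoryTheory.Functor.map_id, Category.comp_id]

theorem permAction_ι_f (M : Mat_ (TPow k C d)) :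
    ((permAction k C d).ι.hom.app ((Idempotents.toKaroubi _).obj M)).f = 𝟙 M := by
  change ((eqToIso (psMap_id _ TPow.perm_one)).hom.app _).f = _
  rw [eqToIso.hom, eqToHom_app, Idempotents.Karoubi.eqToHom_f]
  exact Category.comp_id (𝟙 M)

end PermAction

variable (k : Type w) [CommRing k] {C : Type u} [Category.{v} C] [Preadditive C]
  [Linear k C] [LinearWithUnit k C] {I J K : Type} (d : ℕ)

/-- The sequences `(i_1, …, i_d)` in `I ⊔ {∅}` in which each `i ∈ I` occurs exactly once. They
index the summands of `⟨U_I⟩_d`. -/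
@[ext]
structure Seq (I : Type) (d : ℕ) where
  val : Fin d → Option I
  once : ∀ i, ∃! a, val a = some i

instance [Finite I] : Fintype (Seq I d) :=
  @Fintype.ofFinite _ (Finite.of_injective Seq.val fun _ _ h => Seq.ext h)

/-- Permutation of the terms of a sequence. -/
def Seq.perm {d : ℕ} (g : Equiv.Perm (Fin d)) : Seq I d ≃ Seq I d where
  toFun x := ⟨fun a => x.val (g.symm a), fun i => by
    obtain ⟨a, ha, hu⟩ := x.once i
    exact ⟨g a, by simpa using ha, fun b hb => by rw [← hu _ hb, g.apply_symm_apply]⟩⟩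
  invFun x := ⟨fun a => x.val (g a), fun i => by
    obtain ⟨a, ha, hu⟩ := x.once i
    exact ⟨g.symm a, by simpa using ha, fun b hb => by rw [← hu _ hb, g.symm_apply_apply]⟩⟩
  left_inv x := Seq.ext (funext fun a => congrArg x.val (g.symm_apply_apply a))
  right_inv x := Seq.ext (funext fun a => congrArg x.val (g.apply_symm_apply a))

/-- The direct sum of `U_{i_1} ⊠ ⋯ ⊠ U_{i_d}` over all sequences in `Seq I d`. -/
def brMat [Finite I] (U : I → C) : Mat_ (TPow k C d) where
  ι := Seq I d
  X x := ⟨fun a => obj k U (x.val a)⟩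

/-- The structure isomorphism `g · ⟨U_I⟩_d ≅ ⟨U_I⟩_d`, which identifies the summand
`g · (U_{i_1} ⊠ ⋯ ⊠ U_{i_d})` with the summand of the permuted sequence. -/
def brIso [Finite I] (U : I → C) (g : Equiv.Perm (Fin d)) :
    (TPow.perm g).mapMat_.obj (brMat k d U) ≅ brMat k d U :=
  matIso (M := (TPow.perm g).mapMat_.obj (brMat k d U)) (N := brMat k d U) (Seq.perm g)
    fun _ => rfl

theorem brIso_mul [Finite I] (U : I → C) (g h : Equiv.Perm (Fin d)) :
    (TPow.perm g).mapMat_.map (brIso k d U h).hom ≫ (brIso k d U g).hom =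
      (brIso k d U (g * h)).hom := by
  have h1 := mapMat_matHom (M := (TPow.perm h).mapMat_.obj (brMat k d U)) (N := brMat k d U)
    (TPow.perm g) (Seq.perm h) fun _ => rfl
  exact (congrArg (· ≫ (brIso k d U g).hom) h1).trans
    (matHom_matHom (M := (TPow.perm g).mapMat_.obj (brMat k d U)) (N := brMat k d U) _ _ _
      fun _ => rfl)

theorem brIso_one [Finite I] (U : I → C) : (brIso k d U 1).hom = 𝟙 (brMat k d U) :=
  matHom_id (M := brMat k d U) (Seq.perm 1) (fun _ => rfl) rfl

/-- The object `⟨U_I⟩_d = U_{i_1} * ⋯ * U_{i_m} * 𝟙^{⊠ (d - m)}` of `W_d(C)`, the object induced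
from a Young subgroup; it is zero when `d < m`. -/
def brObj [Finite I] (U : I → C) : Wd k C d where
  X := (Idempotents.toKaroubi _).obj (brMat k d U)
  κ g :=
    { hom := ⟨(brIso k d U g).hom, by
        change (TPow.perm g).mapMat_.map (𝟙 _) ≫ _ ≫ 𝟙 _ = _
        rw [CategoryTheory.Functor.map_id, Category.comp_id, Category.id_comp]⟩
      inv := ⟨(brIso k d U g).inv, by
        change 𝟙 _ ≫ _ ≫ (TPow.perm g).mapMat_.map (𝟙 _) = _
        rw [CategoryTheory.Functor.map_id, Category.comp_id, Category.id_comp]⟩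
      hom_inv_id := by
        apply Idempotents.Karoubi.hom_ext
        refine (brIso k d U g).hom_inv_id.trans ?_
        exact ((TPow.perm g).mapMat_.map_id (brMat k d U)).symm
      inv_hom_id := by
        apply Idempotents.Karoubi.hom_ext
        exact (brIso k d U g).inv_hom_id }
  κ_mul g h := by
    apply Idempotents.Karoubi.hom_ext
    rw [Idempotents.Karoubi.comp_f, Idempotents.Karoubi.comp_f, permAction_μ_f]
    exact (brIso_mul k d U g h).trans (Category.id_comp _).symm
  κ_one := by
    apply Idempotents.Karoubi.hom_ext
    rw [Idempotents.Karoubi.comp_f, permAction_ι_f]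
    exact (Category.id_comp _).trans (brIso_one k d U)

/-- The sequence of pairs `s` is adapted to `r`: apart from the terms `(∅, ∅)`, it consists of
the pairs of `r`, each occurring once. -/
def Adapted {d : ℕ} (s : Fin d → Option I × Option J) (r : Rec₂ I J) : Prop :=
  (∀ p ∈ r.pairs, ∃! a, s a = p) ∧ ∀ a, s a = (none, none) ∨ s a ∈ r.pairs

/-- The morphism `Φ` between external tensor products (after reordering the terms and inserting
identities of `𝟙`) at a cell whose sequence of pairs is adapted to `r`. -/
def brAdapted (U : I → C) (V : J → C) (r : Rec₂ I J) (x : Seq I d) (y : Seq J d)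
    (h : Adapted (fun a => (x.val a, y.val a)) r) :
    HRec k U V r →ₗ[k] ((⟨fun a => obj k U (x.val a)⟩ : TPow k C d) ⟶
      ⟨fun a => obj k V (y.val a)⟩) :=
  spread k U V r.pairs (fun a => (x.val a, y.val a)) h.1

open Classical in
/-- The matrix entry of `⟨Φ⟩_d` at a cell: it is `Φ` if the sequence of pairs is adapted to `r`,
and zero otherwise. -/
def brEntry (U : I → C) (V : J → C) (r : Rec₂ I J) (x : Seq I d) (y : Seq J d) :
    HRec k U V r →ₗ[k] ((⟨fun a => obj k U (x.val a)⟩ : TPow k C d) ⟶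
      ⟨fun a => obj k V (y.val a)⟩) :=
  if h : Adapted (fun a => (x.val a, y.val a)) r then brAdapted k d U V r x y h else 0

/-- The matrix of `⟨Φ⟩_d` for `Φ ∈ H_r(U; V)`. -/
def brRec [Finite I] [Finite J] (U : I → C) (V : J → C) (r : Rec₂ I J) :
    HRec k U V r →ₗ[k] (brMat k d U ⟶ brMat k d V) :=
  LinearMap.pi fun x : Seq I d => LinearMap.pi fun y : Seq J d => brEntry k d U V r x y

theorem adapted_perm {d : ℕ} (g : Equiv.Perm (Fin d)) (s : Fin d → Option I × Option J)
    (r : Rec₂ I J) : Adapted (fun a => s (g.symm a)) r ↔ Adapted s r := by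
  refine and_congr (forall₂_congr fun p _ => ⟨?_, ?_⟩) ⟨fun h a => ?_, fun h a => h _⟩
  · rintro ⟨a, ha, hu⟩
    refine ⟨g.symm a, ha, fun b hb => ?_⟩
    rw [← hu (g b) (by simpa using hb), g.symm_apply_apply]
  · rintro ⟨a, ha, hu⟩
    refine ⟨g a, by simpa using ha, fun b hb => ?_⟩
    rw [← hu _ hb, g.apply_symm_apply]
  · simpa using h (g a)

theorem brEntry_of_adapted (U : I → C) (V : J → C) (r : Rec₂ I J) (x : Seq I d) (y : Seq J d)
    (h : Adapted (fun a => (x.val a, y.val a)) r) (φ : ∀ p, MorFam k U V r.pairs p) :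
    brEntry k d U V r x y (PiTensorProduct.tprod k φ) =
      TPow.tmor fun a => fill k U V r.pairs φ (x.val a, y.val a) := by
  rw [brEntry, dif_pos h]
  exact spread_tprod ..

theorem brEntry_of_not_adapted (U : I → C) (V : J → C) (r : Rec₂ I J) (x : Seq I d) (y : Seq J d)
    (h : ¬ Adapted (fun a => (x.val a, y.val a)) r) : brEntry k d U V r x y = 0 :=
  dif_neg h

theorem brEntry_perm (U : I → C) (V : J → C) (r : Rec₂ I J)
    (Φ : HRec k U V r) (g : Equiv.Perm (Fin d)) (x : Seq I d) (y : Seq J d) :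
    brEntry k d U V r (Seq.perm g x) (Seq.perm g y) Φ =
      TPow.permHom g _ _ (brEntry k d U V r x y Φ) := by
  by_cases h : Adapted (fun a => (x.val a, y.val a)) r
  · have h' : Adapted (fun a => ((Seq.perm g x).val a, (Seq.perm g y).val a)) r :=
      (adapted_perm g _ r).2 h
    induction Φ using PiTensorProduct.induction_on with
    | add Φ Ψ h1 h2 => rw [map_add, map_add, h1, h2, map_add]; rfl
    | smul_tprod c φ =>
      rw [map_smul, map_smul, map_smul, brEntry_of_adapted k d U V r x y h,
        brEntry_of_adapted k d U V r _ _ h', TPow.permHom_tmor]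
      rfl
  · have h' : ¬ Adapted (fun a => ((Seq.perm g x).val a, (Seq.perm g y).val a)) r :=
      fun h' => h ((adapted_perm g _ r).1 h')
    rw [brEntry_of_not_adapted k d U V r x y h, brEntry_of_not_adapted k d U V r _ _ h',
      LinearMap.zero_apply, LinearMap.zero_apply, map_zero]
    rfl

theorem brRec_invariant [Finite I] [Finite J] (U : I → C) (V : J → C) (r : Rec₂ I J)
    (Φ : HRec k U V r) (g : Equiv.Perm (Fin d)) :
    (brIso k d U g).hom ≫ brRec k d U V r Φ =
      (TPow.perm g).mapMat_.map (brRec k d U V r Φ) ≫ (brIso k d V g).hom := by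
  apply Mat_.hom_ext
  intro x y
  obtain ⟨y, rfl⟩ := (Seq.perm g).surjective y
  refine (matHom_comp (M := (TPow.perm g).mapMat_.obj (brMat k d U)) (N := brMat k d U)
    (Seq.perm g) (fun _ => rfl) _ x _).trans ?_
  refine Eq.trans ?_ (comp_matHom (M := (TPow.perm g).mapMat_.obj (brMat k d V))
    (N := brMat k d V) (Seq.perm g) (fun _ => rfl) _ x y).symm
  refine (Category.id_comp _).trans (Eq.trans ?_ (Category.comp_id _).symm)
  exact brEntry_perm k d U V r Φ g x y

/-- The map `Φ ↦ ⟨Φ⟩_d` on `H_r(U; V)`. -/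
def brRecHom [Finite I] [Finite J] (U : I → C) (V : J → C) (r : Rec₂ I J) :
    HRec k U V r →ₗ[k] (brObj k d U ⟶ brObj k d V) where
  toFun Φ := ⟨(Idempotents.toKaroubi _).map (brRec k d U V r Φ), fun g => by
    apply Idempotents.Karoubi.hom_ext
    exact brRec_invariant k d U V r Φ g⟩
  map_add' Φ Ψ := by
    apply Subtype.ext
    apply Idempotents.Karoubi.hom_ext
    exact map_add _ _ _
  map_smul' a Φ := by
    apply Subtype.ext
    apply Idempotents.Karoubi.hom_ext
    exact map_smul _ _ _

open Classical in
/-- The map `Φ ↦ ⟨Φ⟩_d` from `H(U; V)` to `Hom(⟨U⟩_d, ⟨V⟩_d)`. -/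
def brHom [Finite I] [Finite J] (U : I → C) (V : J → C) :
    HTot k U V →ₗ[k] (brObj k d U ⟶ brObj k d V) :=
  DirectSum.toModule k _ _ fun r => brRecHom k d U V r

end Bracket
end WreathCat
end

open WreathCat

/-!
Sequences with `d` terms are used as coordinates on recollements. A sequence in `Seq I d` is the
same as an injection of `I` into the set of `d` places. A triple of sequences `(x, y, z)` induces
the partition of `I ⊔ J ⊔ K` according to places, and it *realizes* the recollement `u` if this
partition is `u`; adaptedness of a pair of sequences is the analogous condition for two sets
(`adapted_iff`). Three facts carry the theorem.

* Counting. The injections of the classes of a partition into `d` places which extend a given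
  injection of some of the classes are counted by a falling product (`card_extension`). In
  particular, if `(x, z)` realizes `π₁₃ u`, there are `P_u(d)` sequences `y` such that `(x, y, z)`
  realizes `u` (`card_realizing`).
* Composition. If `(x, y, z)` realizes `u`, the entry of `Ψ ∘_u Φ` at `(x, z)` is the composite of
  the entries of `Φ` at `(x, y)` and of `Ψ` at `(y, z)` (`brEntry_compGlue`): the orphans of `u`
  sit at places where the composite is an endomorphism of `𝟙`, that is, a scalar.
* Faithfulness. At an adapted pair of sequences the entry determines the element of `H_r(U; V)`
  (`brEntry_injective`), as the inserted factors `End 𝟙` are copies of `k`.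

The composition formula in the wreath product follows by sorting the sequences `y` in the matrix
product according to the recollement which `(x, y, z)` realizes.

For associativity at an arbitrary parameter `t`, both sides become sums over the partitions `w` of
`I ⊔ J ⊔ K ⊔ L`. The coefficients match by the identity `P_u P_v = ∑_w P_w`, where `w` runs over the
partitions restricting to `u` and `v`; it is an identity between integral polynomials, which
holds at all large integers by counting maps to a finite set in two ways (`fallPoly_mul_fallPoly`).
The terms match because, in a realization of `w`, the two iterated compositions have as entries
the two bracketings of a composite in a tensor power of `C`, where composition is associative
(`incl_compGlue_compGlue`). The unit laws hold since the only gluing of `r` with a diagonal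
recollement has no orphans (`compTot_eq_of_unique`).
-/

namespace WreathCat

/-! ### Counting extensions of maps with a prescribed kernel -/

section Counting

variable {E F A : Type}

/-- The maps `f : F → A` which separate exactly the classes of `R` and extend `g` along `ι`. -/
abbrev Extension (ι : E → F) (R : Setoid F) (g : E → A) : Type :=
  {f : F → A // Setoid.ker f = R ∧ f ∘ ι = g}

/-- An extension of `g` amounts to an injection of the remaining classes of `R` into the
complement of the range of `g`. -/
noncomputable def Extension.equivEmbedding (ι : E → F) (R : Setoid F) (g : E → A)
    (hg : Setoid.ker g = R.comap ι) :
    Extension ι R g ≃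
      (((Set.range fun e => (⟦ι e⟧ : Quotient R))ᶜ : Set (Quotient R)) ↪
        ((Set.range g)ᶜ : Set A)) := by
  classical
  have rel {f : F → A} (hf : Setoid.ker f = R) (x y : F) : R x y ↔ f x = f y := by
    rw [← hf]; exact Setoid.ker_def
  have relg (e e' : E) : g e = g e' ↔ R (ι e) (ι e') := by
    rw [← Setoid.comap_rel, ← hg]; exact Setoid.ker_def.symm
  refine Equiv.ofBijective (fun f => ⟨fun q => ⟨Quotient.lift f.1
    (fun x y h => (rel f.2.1 x y).1 h) q.1, ?_⟩, ?_⟩) ⟨?_, ?_⟩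
  · obtain ⟨q, hq⟩ := q
    induction q using Quotient.inductionOn with
    | h x =>
      rintro ⟨e, he⟩
      refine hq ⟨e, Quotient.sound ((rel f.2.1 _ _).2 ?_)⟩
      exact (congrFun f.2.2 e).trans he
  · rintro ⟨q, hq⟩ ⟨q', hq'⟩ h
    induction q using Quotient.inductionOn with
    | h x =>
      induction q' using Quotient.inductionOn with
      | h y => exact Subtype.ext (Quotient.sound ((rel f.2.1 _ _).2 (congrArg Subtype.val h)))
  · rintro ⟨f, hf, hfg⟩ ⟨f', hf', hfg'⟩ h
    refine Subtype.ext (funext fun x => ?_)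
    by_cases hx : (⟦x⟧ : Quotient R) ∈ Set.range fun e => (⟦ι e⟧ : Quotient R)
    · obtain ⟨e, he⟩ := hx
      have he : R (ι e) x := Quotient.exact he
      have h1 := (rel hf _ _).1 he
      have h2 := (rel hf' _ _).1 he
      change f x = f' x
      rw [← h1, ← h2]
      exact (congrFun hfg e).trans (congrFun hfg' e).symm
    · exact congrArg Subtype.val (DFunLike.congr_fun h ⟨⟦x⟧, hx⟩)
  · intro h
    let f : F → A := fun x => if hx : (⟦x⟧ : Quotient R) ∈ Set.range fun e => (⟦ι e⟧ : Quotient R)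
      then g hx.choose else (h ⟨⟦x⟧, hx⟩).1
    have f_ι (x : F) (e : E) (hx : R (ι e) x) : f x = g e := by
      have hx' : (⟦x⟧ : Quotient R) ∈ Set.range fun e => (⟦ι e⟧ : Quotient R) :=
        ⟨e, Quotient.sound hx⟩
      rw [show f x = g hx'.choose from dif_pos hx', relg]
      exact R.trans (Quotient.exact hx'.choose_spec) (R.symm hx)
    have f_h (x : F) (hx : (⟦x⟧ : Quotient R) ∉ Set.range fun e => (⟦ι e⟧ : Quotient R)) :
        f x = (h ⟨⟦x⟧, hx⟩).1 := dif_neg hx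
    refine ⟨⟨f, Setoid.ext fun x y => ?_, funext fun e => f_ι _ e (R.refl _)⟩, ?_⟩
    · rw [Setoid.ker_def]
      by_cases hx : (⟦x⟧ : Quotient R) ∈ Set.range fun e => (⟦ι e⟧ : Quotient R)
      · obtain ⟨e, he⟩ := hx
        have he : R (ι e) x := Quotient.exact he
        rw [f_ι x e he]
        by_cases hy : (⟦y⟧ : Quotient R) ∈ Set.range fun e => (⟦ι e⟧ : Quotient R)
        · obtain ⟨e', he'⟩ := hy
          have he' : R (ι e') y := Quotient.exact he'
          rw [f_ι y e' he', relg]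
          exact ⟨fun h => R.trans (R.symm he) (R.trans h he'),
            fun h => R.trans he (R.trans h (R.symm he'))⟩
        · rw [f_h y hy]
          exact ⟨fun h' => ((h ⟨⟦y⟧, hy⟩).2 ⟨e, h'⟩).elim,
            fun h' => (hy ⟨e, Quotient.sound (R.trans he h')⟩).elim⟩
      · rw [f_h x hx]
        by_cases hy : (⟦y⟧ : Quotient R) ∈ Set.range fun e => (⟦ι e⟧ : Quotient R)
        · obtain ⟨e, he⟩ := hy
          have he : R (ι e) y := Quotient.exact he
          rw [f_ι y e he]
          exact ⟨fun h' => ((h ⟨⟦x⟧, hx⟩).2 ⟨e, h'.symm⟩).elim,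
            fun h' => (hx ⟨e, Quotient.sound (R.trans he (R.symm h'))⟩).elim⟩
        · rw [f_h y hy, Subtype.coe_inj, h.injective.eq_iff, Subtype.mk.injEq]
          exact Quotient.eq
    · ext ⟨q, hq⟩
      induction q using Quotient.inductionOn with
      | h x => exact f_h x hq

theorem card_quotient_ker {F A : Type} (f : F → A) :
    Nat.card (Quotient (Setoid.ker f)) = Nat.card (Set.range f) :=
  Nat.card_congr (Setoid.quotientKerEquivRange f)

/-- The polynomial `∏ (T - a)`, with `a` running from the number of classes of the restriction of
`R` along `ι` to the number of classes of `R`. -/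
noncomputable def fallPoly (k : Type w) [CommRing k] (ι : E → F) (R : Setoid F) : Polynomial k :=
  ∏ a ∈ Finset.Ico (Nat.card (Quotient (R.comap ι))) (Nat.card (Quotient R)),
    (Polynomial.X - Polynomial.C (a : k))

theorem cast_descFactorial_sub (k : Type w) [CommRing k] {m n d : ℕ} (hmn : m ≤ n) (hmd : m ≤ d) :
    (((d - m).descFactorial (n - m) : ℕ) : k) = ∏ a ∈ Finset.Ico m n, ((d : k) - a) := by
  induction n, hmn using Nat.le_induction with
  | base => simp
  | succ n hn ih =>
    rw [Finset.prod_Ico_succ_top hn, ← ih, Nat.succ_sub hn, Nat.descFactorial_succ, Nat.cast_mul,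
      mul_comm]
    rcases le_or_gt n d with h | h
    · rw [show d - m - (n - m) = d - n by omega, Nat.cast_sub h]
    -- Past `n = d` the factor `d - n` is truncated, but the other one already vanishes.
    · rw [Nat.descFactorial_eq_zero_iff_lt.2 (by omega)]
      simp

/-- There are `∏ (|A| - a)` extensions of `g`, where `a` runs from the number of classes of `R`
which meet the image of `ι` to the number of all classes of `R`. -/
theorem card_extension (k : Type w) [CommRing k] [Finite F] [Finite A] (ι : E → F)
    (R : Setoid F) (g : E → A) (hg : Setoid.ker g = R.comap ι) :
    (Nat.card (Extension ι R g) : k) = (fallPoly k ι R).eval (Nat.card A : k) := by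
  have := Fintype.ofFinite A
  classical
  have := Fintype.ofFinite (Quotient R)
  have hq : Nat.card (Quotient (R.comap ι)) =
      Nat.card (Set.range fun e => (⟦ι e⟧ : Quotient R)) := by
    rw [Setoid.comap_eq, card_quotient_ker]; rfl
  have hA : Nat.card (Quotient (R.comap ι)) = Nat.card (Set.range g) := by
    rw [← hg, card_quotient_ker]
  rw [Nat.card_congr (Extension.equivEmbedding ι R g hg), Nat.card_eq_fintype_card,
    Fintype.card_embedding_eq, ← Nat.card_eq_fintype_card, ← Nat.card_eq_fintype_card,
    Nat.card_coe_set_eq, Nat.card_coe_set_eq, Set.ncard_compl, Set.ncard_compl,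
    ← Nat.card_coe_set_eq, ← Nat.card_coe_set_eq, ← hA, ← hq, cast_descFactorial_sub, fallPoly,
    Polynomial.eval_prod]
  · simp
  · rw [hq]; exact Nat.card_le_card_of_injective _ Subtype.val_injective
  · rw [hA]; exact Nat.card_le_card_of_injective _ Subtype.val_injective

theorem exists_ker_eq [Finite F] (R : Setoid F) {d : ℕ} (hd : Nat.card (Quotient R) ≤ d) :
    ∃ f : F → Fin d, Setoid.ker f = R := by
  refine ⟨fun x => Fin.castLE hd (Finite.equivFin (Quotient R) ⟦x⟧), Setoid.ext fun x y => ?_⟩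
  rw [Setoid.ker_def, (Fin.castLE_injective hd).eq_iff, EmbeddingLike.apply_eq_iff_eq]
  exact Quotient.eq

theorem fallPoly_map (k : Type w) [CommRing k] (ι : E → F) (R : Setoid F) :
    (fallPoly ℤ ι R).map (Int.castRingHom k) = fallPoly k ι R := by
  simp [fallPoly, Polynomial.map_prod]

/-- Let `G` be the pushout of `F` and `F'` along `F₀`, and let `E` be mapped to `F`. The product of
the polynomials of `F₀ → F'` and `E → F` is the sum of the polynomials of `E → G` over all the
partitions of `G` which restrict to the given ones. At a large integer `d` both sides count the
extensions to `G` of a fixed map from `E` to a set with `d` elements. -/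
theorem fallPoly_mul_fallPoly (k : Type w) [CommRing k] {E F₀ F F' G : Type} [Finite E]
    [Finite F] [Finite F'] [Finite G] (i : E → F) (c : F₀ → F) (c' : F₀ → F') (a : F → G)
    (a' : F' → G) [Fintype (Setoid G)]
    (hac : a ∘ c = a' ∘ c')
    (glue : ∀ (A : Type) (f : F → A) (f' : F' → A), f ∘ c = f' ∘ c' →
      ∃ h : G → A, h ∘ a = f ∧ h ∘ a' = f')
    (cover : ∀ x, (∃ y, a y = x) ∨ ∃ y, a' y = x)
    (R : Setoid F) (R' : Setoid F') (hR : R.comap c = R'.comap c') (t : k)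
    [DecidablePred fun w : Setoid G => w.comap a = R ∧ w.comap a' = R'] :
    (fallPoly k c' R').eval t * (fallPoly k i R).eval t =
      ∑ w : Setoid G with w.comap a = R ∧ w.comap a' = R',
        (fallPoly k (a ∘ i) w).eval t := by
  classical
  suffices h : fallPoly ℤ c' R' * fallPoly ℤ i R =
      ∑ w : Setoid G with w.comap a = R ∧ w.comap a' = R', fallPoly ℤ (a ∘ i) w by
    have h2 := congrArg (fun p => (p.map (Int.castRingHom k)).eval t) h
    simpa [Polynomial.map_mul, Polynomial.map_sum, fallPoly_map, Polynomial.eval_finsetSum]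
      using h2
  refine Polynomial.eq_of_infinite_eval_eq _ _ (Set.Infinite.mono ?_
    ((Set.Ici_infinite (Nat.card (Quotient (R.comap i)))).image
      (Nat.cast_injective (R := ℤ)).injOn))
  rintro _ ⟨d, hd, rfl⟩
  obtain ⟨g, hg⟩ := exists_ker_eq (R.comap i) hd
  have hA : Nat.card (Fin d) = d := by simp
  -- An extension to `G` is one to `F` followed by a compatible one to `F'`; it is also a partition
  -- of `G` followed by an extension with this partition as kernel.
  let X := {h : G → Fin d // Setoid.ker (h ∘ a) = R ∧ Setoid.ker (h ∘ a') = R' ∧ h ∘ a ∘ i = g}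
  let e₁ : X ≃ Σ f : Extension i R g, Extension c' R' (f.1 ∘ c) :=
    Equiv.ofBijective (fun h => ⟨⟨h.1 ∘ a, h.2.1, h.2.2.2⟩, ⟨h.1 ∘ a', h.2.2.1, by
      rw [Function.comp_assoc, Function.comp_assoc, hac]⟩⟩) (by
      constructor
      · rintro ⟨h, hh⟩ ⟨h', hh'⟩ H
        have H1 : h ∘ a = h' ∘ a := congrArg (fun p => p.1.1) H
        have H2 : h ∘ a' = h' ∘ a' := congrArg
          (fun p : Σ f : Extension i R g, Extension c' R' (f.1 ∘ c) => p.2.1) H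
        refine Subtype.ext (funext fun x => ?_)
        rcases cover x with ⟨y, rfl⟩ | ⟨y, rfl⟩
        exacts [congrFun H1 y, congrFun H2 y]
      · rintro ⟨⟨f, hf, hfg⟩, ⟨f', hf', hfg'⟩⟩
        obtain ⟨h, rfl, rfl⟩ := glue _ f f' hfg'.symm
        exact ⟨⟨h, hf, hf', hfg⟩, rfl⟩)
  let e₂ : X ≃ Σ w : {w : Setoid G // w.comap a = R ∧ w.comap a' = R'},
      Extension (a ∘ i) w.1 g :=
    { toFun h := ⟨⟨Setoid.ker h.1, h.2.1, h.2.2.1⟩, ⟨h.1, rfl, h.2.2.2⟩⟩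
      invFun p := ⟨p.2.1, by
        obtain ⟨⟨w, h1, h2⟩, f, h3, h4⟩ := p
        cases h3
        exact ⟨h1, h2, h4⟩⟩
      left_inv h := rfl
      right_inv := by rintro ⟨⟨w, h1, h2⟩, f, h3, h4⟩; cases h3; rfl }
  have := Fintype.ofFinite (Extension i R g)
  have := Fintype.ofFinite {w : Setoid G // w.comap a = R ∧ w.comap a' = R'}
  have hcard := (Nat.card_congr e₁).symm.trans (Nat.card_congr e₂)
  rw [Nat.card_sigma, Nat.card_sigma] at hcard
  have hcard' := congrArg (Nat.cast (R := ℤ)) hcard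
  rw [Nat.cast_sum, Nat.cast_sum] at hcard'
  have hl (f : Extension i R g) : (Nat.card (Extension c' R' (f.1 ∘ c)) : ℤ) =
      (fallPoly ℤ c' R').eval (d : ℤ) := by
    rw [card_extension ℤ c' R' (f.1 ∘ c) (by
      rw [← hR]; exact congrArg (Setoid.comap c) f.2.1), hA]
  have hr (w : {w : Setoid G // w.comap a = R ∧ w.comap a' = R'}) :
      (Nat.card (Extension (a ∘ i) w.1 g) : ℤ) = (fallPoly ℤ (a ∘ i) w.1).eval (d : ℤ) := by
    rw [card_extension ℤ _ w.1 g (by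
      rw [hg]; exact congrArg (Setoid.comap i) w.2.1.symm), hA]
  simp only [hl, hr] at hcard'
  rw [Finset.sum_const, nsmul_eq_mul, Finset.card_univ, ← Nat.card_eq_fintype_card,
    card_extension ℤ i R g hg, hA] at hcard'
  change Polynomial.eval _ _ = Polynomial.eval _ _
  rw [Polynomial.eval_mul, Polynomial.eval_finsetSum, mul_comm, hcard']
  exact (Finset.sum_subtype _ (fun w => by simp) fun w : Setoid G =>
    (fallPoly ℤ (a ∘ i) w).eval (d : ℤ)).symm

end Counting

/-! ### Realizations of recollements by sequences -/

section Realizations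

variable {I J K : Type} {d : ℕ}

/-- The place at which `i` occurs in the sequence `x`. -/
noncomputable def Seq.pos (x : Seq I d) (i : I) : Fin d := (x.once i).choose

theorem Seq.val_eq_some_iff (x : Seq I d) (a : Fin d) (i : I) :
    x.val a = some i ↔ x.pos i = a :=
  ⟨fun h => ((x.once i).choose_spec.2 a h).symm, fun h => h ▸ (x.once i).choose_spec.1⟩

theorem Seq.pos_injective (x : Seq I d) : Function.Injective x.pos := fun i j h =>
  Option.some_injective _ (((x.val_eq_some_iff _ i).2 h).symm.trans ((x.val_eq_some_iff _ j).2 rfl))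

theorem Seq.ext_pos {x y : Seq I d} (h : x.pos = y.pos) : x = y :=
  Seq.ext (funext fun a => Option.ext fun i => by rw [x.val_eq_some_iff, y.val_eq_some_iff, h])

theorem Seq.exists_pos_eq (f : I → Fin d) (hf : Function.Injective f) :
    ∃ x : Seq I d, x.pos = f := by
  classical
  have hval (a : Fin d) : ∃ o : Option I, ∀ i, o = some i ↔ f i = a := by
    by_cases h : ∃ i, f i = a
    · obtain ⟨i, rfl⟩ := h
      exact ⟨some i, fun j => by rw [Option.some_inj, hf.eq_iff, eq_comm]⟩
    · exact ⟨none, fun i => ⟨fun h' => (by cases h'), fun h' => (h ⟨i, h'⟩).elim⟩⟩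
  choose val hval using hval
  let x : Seq I d := ⟨val, fun i => ⟨f i, (hval _ _).2 rfl, fun a ha => ((hval a i).1 ha).symm⟩⟩
  exact ⟨x, funext fun i => (x.val_eq_some_iff _ _).1 ((hval _ _).2 rfl)⟩

/-- The map sending each point of `I ⊔ J` to its place in a pair of sequences. -/
noncomputable def pos₂ (x : Seq I d) (y : Seq J d) : I ⊕ J → Fin d := Sum.elim x.pos y.pos

/-- The map sending each point of `I ⊔ J ⊔ K` to its place in a triple of sequences. -/
noncomputable def pos₃ (x : Seq I d) (y : Seq J d) (z : Seq K d) : I ⊕ J ⊕ K → Fin d :=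
  Sum.elim x.pos (Sum.elim y.pos z.pos)

theorem mem_block₂_iff (x : Seq I d) (y : Seq J d) (a : Fin d) (e : I ⊕ J) :
    e ∈ block₂ (x.val a, y.val a) ↔ pos₂ x y e = a := by
  rcases e with i | j
  exacts [x.val_eq_some_iff a i, y.val_eq_some_iff a j]

theorem mem_block₃_iff (x : Seq I d) (y : Seq J d) (z : Seq K d) (a : Fin d) (e : I ⊕ J ⊕ K) :
    e ∈ block₃ (x.val a, y.val a, z.val a) ↔ pos₃ x y z e = a := by
  rcases e with i | j | l
  exacts [x.val_eq_some_iff a i, y.val_eq_some_iff a j, z.val_eq_some_iff a l]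

theorem block₂_injective : Function.Injective (block₂ (I := I) (J := J)) := by
  rintro ⟨x, y⟩ ⟨x', y'⟩ h
  exact Prod.ext (Option.ext fun i => iff_of_eq (congrArg (fun s => Sum.inl i ∈ s) h))
    (Option.ext fun j => iff_of_eq (congrArg (fun s => Sum.inr j ∈ s) h))

theorem block₃_injective : Function.Injective (block₃ (I := I) (J := J) (K := K)) := by
  rintro ⟨x, y, z⟩ ⟨x', y', z'⟩ h
  exact Prod.ext (Option.ext fun i => iff_of_eq (congrArg (fun s => Sum.inl i ∈ s) h))
    (Prod.ext (Option.ext fun j => iff_of_eq (congrArg (fun s => Sum.inr (Sum.inl j) ∈ s) h))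
      (Option.ext fun l => iff_of_eq (congrArg (fun s => Sum.inr (Sum.inr l) ∈ s) h)))

theorem eq_none_or_exists_pos₂ (x : Seq I d) (y : Seq J d) (a : Fin d) :
    (x.val a, y.val a) = (none, none) ∨ ∃ e, pos₂ x y e = a := by
  rcases hx : x.val a with _ | i
  · rcases hy : y.val a with _ | j
    · exact .inl rfl
    · exact .inr ⟨.inr j, (y.val_eq_some_iff a j).1 hy⟩
  · exact .inr ⟨.inl i, (x.val_eq_some_iff a i).1 hx⟩

/-- A pair of sequences is adapted to `r` if and only if `r` is the partition according to the
places of the points. -/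
theorem adapted_iff (x : Seq I d) (y : Seq J d) (r : Rec₂ I J) :
    Adapted (fun a => (x.val a, y.val a)) r ↔ Setoid.ker (pos₂ x y) = r.rel := by
  constructor
  · intro h
    refine Setoid.ext fun e' e => ?_
    have he : e ∈ block₂ (x.val (pos₂ x y e), y.val (pos₂ x y e)) := (mem_block₂_iff ..).2 rfl
    have hne : (x.val (pos₂ x y e), y.val (pos₂ x y e)) ≠ (none, none) := by
      intro h
      rw [h] at he
      rcases e with i | j <;> cases he
    obtain ⟨e₀, h₀⟩ := (h.2 (pos₂ x y e)).resolve_left hne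
    have h₁ (e') : pos₂ x y e' = pos₂ x y e ↔ r.rel e' e₀ := by
      rw [← mem_block₂_iff]
      exact iff_of_eq (congrArg (fun s => e' ∈ s) h₀)
    rw [Setoid.ker_def, h₁]
    have h₂ := (h₁ e).1 rfl
    exact ⟨fun h => r.rel.trans h (r.rel.symm h₂), fun h => r.rel.trans h h₂⟩
  · intro h
    have hcls (e : I ⊕ J) : block₂ (x.val (pos₂ x y e), y.val (pos₂ x y e)) =
        {e' | r.rel e' e} := Set.ext fun e' => by
      rw [mem_block₂_iff]
      change _ ↔ r.rel e' e
      rw [← h, Setoid.ker_def]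
    refine ⟨fun p ⟨e, he⟩ => ⟨pos₂ x y e, block₂_injective ((hcls e).trans he.symm), fun b hb => ?_⟩,
      fun a => (eq_none_or_exists_pos₂ x y a).imp_right ?_⟩
    · refine ((mem_block₂_iff x y b e).1 ?_).symm
      have hb : (x.val b, y.val b) = p := hb
      rw [hb, he]
      exact r.rel.refl e
    · rintro ⟨e, rfl⟩
      exact ⟨e, hcls e⟩

theorem Rec₂.eq_of_adapted {x : Seq I d} {y : Seq J d} {r r' : Rec₂ I J}
    (h : Adapted (fun a => (x.val a, y.val a)) r) (h' : Adapted (fun a => (x.val a, y.val a)) r') :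
    r = r' :=
  Rec₂.ext (((adapted_iff ..).1 h).symm.trans ((adapted_iff ..).1 h'))

/-- If `(x, y, z)` realizes `u`, the triples of `u` are those at the nonempty places. -/
theorem mem_triples_iff {x : Seq I d} {y : Seq J d} {z : Seq K d} {u : Rec₃ I J K}
    (h : Setoid.ker (pos₃ x y z) = u.rel) (t : Option I × Option J × Option K) :
    t ∈ u.triples ↔ ∃ e, t = (x.val (pos₃ x y z e), y.val (pos₃ x y z e),
      z.val (pos₃ x y z e)) := by
  refine exists_congr fun e => ?_
  have : block₃ (x.val (pos₃ x y z e), y.val (pos₃ x y z e), z.val (pos₃ x y z e)) =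
      {e' | u.rel e' e} := Set.ext fun e' => by
    rw [mem_block₃_iff]
    change _ ↔ u.rel e' e
    rw [← h, Setoid.ker_def]
  rw [← this, block₃_injective.eq_iff]

theorem adapted₁₂ {x : Seq I d} {y : Seq J d} {z : Seq K d} {u : Rec₃ I J K}
    (h : Setoid.ker (pos₃ x y z) = u.rel) :
    Adapted (fun a => (x.val a, y.val a)) u.π₁₂ := by
  refine (adapted_iff ..).2 (Eq.trans ?_ (congrArg (Setoid.comap (Sum.map id Sum.inl)) h))
  exact congrArg Setoid.ker (funext (by rintro (i | j) <;> rfl))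

theorem adapted₂₃ {x : Seq I d} {y : Seq J d} {z : Seq K d} {u : Rec₃ I J K}
    (h : Setoid.ker (pos₃ x y z) = u.rel) :
    Adapted (fun a => (y.val a, z.val a)) u.π₂₃ := by
  refine (adapted_iff ..).2 (Eq.trans ?_ (congrArg (Setoid.comap Sum.inr) h))
  exact congrArg Setoid.ker (funext (by rintro (i | j) <;> rfl))

theorem adapted₁₃ {x : Seq I d} {y : Seq J d} {z : Seq K d} {u : Rec₃ I J K}
    (h : Setoid.ker (pos₃ x y z) = u.rel) :
    Adapted (fun a => (x.val a, z.val a)) u.π₁₃ := by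
  refine (adapted_iff ..).2 (Eq.trans ?_ (congrArg (Setoid.comap (Sum.map id Sum.inr)) h))
  exact congrArg Setoid.ker (funext (by rintro (i | j) <;> rfl))

/-- A triple of sequences realizes some recollement. -/
theorem exists_realized (x : Seq I d) (y : Seq J d) (z : Seq K d) :
    ∃ u : Rec₃ I J K, Setoid.ker (pos₃ x y z) = u.rel :=
  ⟨⟨Setoid.ker (pos₃ x y z), fun _ _ h => x.pos_injective h, fun _ _ h => y.pos_injective h,
    fun _ _ h => z.pos_injective h⟩, rfl⟩

theorem length₂_eq (r : Rec₂ I J) : r.length = Nat.card (Quotient r.rel) :=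
  (Nat.card_coe_set_eq _).symm.trans (Nat.card_congr (Setoid.quotientEquivClasses r.rel)).symm

theorem length₃_eq (u : Rec₃ I J K) : u.length = Nat.card (Quotient u.rel) :=
  (Nat.card_coe_set_eq _).symm.trans (Nat.card_congr (Setoid.quotientEquivClasses u.rel)).symm

theorem poly_eq_fallPoly (k : Type w) [CommRing k] (u : Rec₃ I J K) :
    u.poly k = fallPoly k (Sum.map id Sum.inr) u.rel := by
  rw [Rec₃.poly, fallPoly, length₂_eq, length₃_eq]
  rfl

/-- If `(x, z)` realizes `π₁₃ u`, there are `P_u(d)` sequences `y` such that `(x, y, z)`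
realizes `u`. -/
theorem card_realizing (k : Type w) [CommRing k] [Finite I] [Finite J] [Finite K] (u : Rec₃ I J K)
    (x : Seq I d) (z : Seq K d) (h : Adapted (fun a => (x.val a, z.val a)) u.π₁₃) :
    (Nat.card {y : Seq J d // Setoid.ker (pos₃ x y z) = u.rel} : k) =
      (u.poly k).eval (d : k) := by
  have hxz := (adapted_iff ..).1 h
  have hcard := card_extension k (Sum.map id Sum.inr) u.rel (pos₂ x z) hxz
  rw [Nat.card_fin] at hcard
  rw [poly_eq_fallPoly, ← hcard]
  refine congrArg _ (Nat.card_congr (Equiv.ofBijective (fun y => ⟨pos₃ x y.1 z, y.2, ?_⟩) ⟨?_, ?_⟩))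
  · funext e
    rcases e with i | l <;> rfl
  · rintro ⟨y, hy⟩ ⟨y', hy'⟩ H
    exact Subtype.ext (Seq.ext_pos (funext fun j =>
      congrFun (congrArg Subtype.val H) (.inr (.inl j))))
  · rintro ⟨f, hf, hfg⟩
    obtain ⟨y, hy⟩ := Seq.exists_pos_eq (fun j => f (.inr (.inl j))) fun j j' H => u.inj₂ j j' (by
      rw [← hf]; exact H)
    have : pos₃ x y z = f := by
      funext e
      rcases e with i | j | l
      exacts [(congrFun hfg (.inl i)).symm, congrFun hy j, (congrFun hfg (.inr l)).symm]
    exact ⟨⟨y, this ▸ hf⟩, Subtype.ext this⟩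

end Realizations

/-! ### Matrix entries of a glued composite -/

section Entries

variable (k : Type w) [CommRing k] {C : Type u} [Category.{v} C] [Preadditive C]
  [Linear k C] [LinearWithUnit k C] {I J K : Type} {d : ℕ}

theorem scalar_idUnit (U : I → C) (W : K → C) : scalar k U W none none (idUnit k U W none none) =
    1 :=
  map_one (LinearWithUnit.endOne (k := k) (C := C))

theorem scalar_smul_idUnit (U : I → C) (W : K → C) (m : obj k U none ⟶ obj k W none) :
    scalar k U W none none m • idUnit k U W none none = m := by
  let e := LinearWithUnit.endOne (k := k) (C := C)
  apply e.injective
  change e ((e m) • (1 : End (LinearWithUnit.one k : C))) = e m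
  rw [map_smul, map_one, smul_eq_mul, mul_one]

theorem fill_none (U : I → C) (V : J → C) (r : Rec₂ I J) (φ : ∀ p, MorFam k U V r.pairs p) :
    fill k U V r.pairs φ (none, none) = idUnit k U V none none :=
  dif_neg r.none_notMem

theorem fill_mem (U : I → C) (V : J → C) (S : Set (Option I × Option J))
    (φ : ∀ p, MorFam k U V S p) (p : S) : fill k U V S φ p.1 = φ p :=
  dif_pos p.2

theorem orphanTerm_none (U : I → C) (W : K → C) (y : Option J)
    (m : obj k U none ⟶ obj k W none) :
    orphanTerm k U W (none, y, none) m = scalar k U W none none m :=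
  if_pos ⟨rfl, rfl⟩

theorem orphanTerm_of_not (U : I → C) (W : K → C) (t : Option I × Option J × Option K)
    (h : ¬ (t.1 = none ∧ t.2.2 = none)) (m : obj k U t.1 ⟶ obj k W t.2.2) :
    orphanTerm k U W t m = 1 :=
  if_neg h

/-- The product of the scalars at the orphans of `u`, taken over the places of a realization of
`u`; the places without orphan contribute `1`. -/
theorem orphanScalar_eq_prod (U : I → C) (W : K → C) {x : Seq I d} {y : Seq J d} {z : Seq K d}
    {u : Rec₃ I J K} (h : Setoid.ker (pos₃ x y z) = u.rel)
    (c : ∀ t : Option I × Option J × Option K, obj k U t.1 ⟶ obj k W t.2.2)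
    (h1 : orphanTerm k U W (none, none, none) (c (none, none, none)) = 1) :
    orphanScalar k U W u (fun t => c t.1) =
      ∏ a, orphanTerm k U W (x.val a, y.val a, z.val a) (c (x.val a, y.val a, z.val a)) := by
  classical
  let trip (a : Fin d) : Option I × Option J × Option K := (x.val a, y.val a, z.val a)
  have hS : ∏ᶠ t : u.triples, orphanTerm k U W t.1 (c t.1) =
      ∏ᶠ t ∈ u.triples, orphanTerm k U W t (c t) :=
    finprod_set_coe_eq_finprod_mem (f := fun t => orphanTerm k U W t (c t)) u.triples
  have htrip : u.triples = trip '' (Set.range (pos₃ x y z)) := by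
    ext t
    rw [mem_triples_iff h, ← Set.range_comp]
    exact exists_congr fun e => eq_comm
  have hinj : Set.InjOn trip (Set.range (pos₃ x y z)) := by
    rintro _ ⟨e, rfl⟩ b _ hab
    refine (mem_block₃_iff x y z b e).1 ?_
    change e ∈ block₃ (trip b)
    rw [← hab]
    exact (mem_block₃_iff x y z _ e).2 rfl
  rw [orphanScalar, hS, htrip, finprod_mem_image hinj, ← finprod_eq_prod_of_fintype]
  refine finprod_congr fun a => ?_
  rw [finprod_eq_if]
  split_ifs with ha
  · rfl
  · have : trip a = (none, none, none) := by
      refine block₃_injective (Set.ext fun e => ?_)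
      rw [mem_block₃_iff]
      refine ⟨fun he => (ha ⟨e, he⟩).elim, fun he => ?_⟩
      rcases e with i | j | l <;> cases he
    change 1 = orphanTerm k U W (trip a) (c (trip a))
    rw [this, h1]

/-- At a place of a realization of `u`, a morphism is the product of its orphan scalar and the
corresponding term of the family without orphans. -/
theorem orphanTerm_smul_fill (U : I → C) (W : K → C) {u : Rec₃ I J K}
    (c : ∀ t : Option I × Option J × Option K, obj k U t.1 ⟶ obj k W t.2.2)
    (t : Option I × Option J × Option K) (ht : t ∈ u.triples ∨ t = (none, none, none)) :
    orphanTerm k U W t (c t) •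
      fill k U W u.π₁₃.pairs (dropOrphans k U W u fun t => c t.1) (t.1, t.2.2) = c t := by
  by_cases h : t.1 = none ∧ t.2.2 = none
  · obtain ⟨x, y, z⟩ := t
    obtain ⟨rfl, rfl⟩ : x = none ∧ z = none := h
    rw [orphanTerm_none, fill_none, scalar_smul_idUnit]
  · have ht := ht.resolve_right fun ht => h (by rw [ht]; exact ⟨rfl, rfl⟩)
    let p : u.π₁₃.pairs := ⟨_, u.mem_pairs₁₃ ht h⟩
    rw [orphanTerm_of_not k U W t h, one_smul]
    refine (fill_mem k U W _ _ p).trans ?_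
    have hm : t.2.1 = u.mid p := congrArg (fun t => t.2.1) (u.mid_unique p ht rfl)
    exact congrArg (fun y => show obj k U t.1 ⟶ obj k W t.2.2 from
      c (t.1, y, t.2.2)) hm.symm

theorem existsUnique₁₃ (u : Rec₃ I J K) (p : Option I × Option K) (hp : p ∈ u.π₁₃.pairs) :
    ∃! t : u.triples, (t.1.1, t.1.2.2) = p :=
  ⟨⟨_, u.mid_mem ⟨p, hp⟩⟩, rfl, fun t ht => Subtype.ext (u.mid_unique ⟨p, hp⟩ t.2 ht)⟩

variable [Finite I] [Finite J] [Finite K]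

/-- Matrix entries are compatible with composition along a realization of `u`. -/
theorem brEntry_compGlue (U : I → C) (V : J → C) (W : K → C) {r : Rec₂ I J} {s : Rec₂ J K}
    (u : Gluing r s) {x : Seq I d} {y : Seq J d} {z : Seq K d}
    (h : Setoid.ker (pos₃ x y z) = u.1.rel) (Φ : HRec k U V r) (Ψ : HRec k V W s) :
    brEntry k d U W u.1.π₁₃ x z (compGlue k U V W u Φ Ψ) =
      brEntry k d U V r x y Φ ≫ brEntry k d V W s y z Ψ := by
  have h12 : Adapted (fun a => (x.val a, y.val a)) r := u.2.1 ▸ adapted₁₂ h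
  have h23 : Adapted (fun a => (y.val a, z.val a)) s := u.2.2 ▸ adapted₂₃ h
  induction Φ using PiTensorProduct.induction_on with
  | add Φ Φ' h1 h2 =>
    rw [map_add, LinearMap.add_apply, map_add, h1, h2, map_add, Preadditive.add_comp]
  | smul_tprod c φ =>
    rw [map_smul, LinearMap.smul_apply, map_smul, map_smul, Linear.smul_comp]
    congr 1
    induction Ψ using PiTensorProduct.induction_on with
    | add Ψ Ψ' h1 h2 => rw [map_add, map_add, h1, h2, map_add, Preadditive.comp_add]
    | smul_tprod c ψ =>
      rw [map_smul, map_smul, map_smul, Linear.comp_smul]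
      congr 1
      let m (t : Option I × Option J × Option K) : obj k U t.1 ⟶ obj k W t.2.2 :=
        fill k U V r.pairs φ (t.1, t.2.1) ≫ fill k V W s.pairs ψ (t.2.1, t.2.2)
      have hm : orphanTerm k U W ((none, none, none) : Option I × Option J × Option K)
          (m (none, none, none)) = 1 := by
        have : m (none, none, none) = idUnit k U W none none := by
          change fill k U V r.pairs φ (none, none) ≫ fill k V W s.pairs ψ (none, none) = _
          rw [fill_none, fill_none]
          exact Category.comp_id _
        rw [orphanTerm_none, this, scalar_idUnit]
      rw [compGlue_tprod, contract_tprod, map_smul,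
        brEntry_of_adapted k d U W _ x z (adapted₁₃ h), brEntry_of_adapted k d U V _ x y h12,
        brEntry_of_adapted k d V W _ y z h23, TPow.tmor_comp_tmor,
        orphanScalar_eq_prod k U W h m hm]
      refine (MultilinearMap.map_smul_univ (PiTensorProduct.tprod k) _ _).symm.trans
        (congrArg (PiTensorProduct.tprod k) (funext fun a =>
          orphanTerm_smul_fill k U W m (x.val a, y.val a, z.val a) ?_))
      by_cases ha : ∃ e, pos₃ x y z e = a
      · obtain ⟨e, rfl⟩ := ha
        exact .inl ((mem_triples_iff h _).2 ⟨e, rfl⟩)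
      · refine .inr (block₃_injective (Set.ext fun e => ?_))
        rw [mem_block₃_iff]
        refine ⟨fun he => (ha ⟨e, he⟩).elim, fun he => ?_⟩
        rcases e with i | j | l <;> cases he

/-- Inserting identities of `𝟙` at the orphans and contracting them again changes nothing. -/
theorem contract_spread (U : I → C) (W : K → C) (u : Rec₃ I J K) (Φ : HRec k U W u.π₁₃) :
    contract k U W u (spread k U W u.π₁₃.pairs (fun t : u.triples => (t.1.1, t.1.2.2))
      (existsUnique₁₃ u) Φ) = Φ := by
  induction Φ using PiTensorProduct.induction_on with
  | add Φ Φ' h1 h2 => rw [map_add, map_add, h1, h2]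
  | smul_tprod c φ =>
    rw [map_smul, map_smul, spread_tprod]
    congr 1
    refine (contract_tprod ..).trans ?_
    have h1 : orphanScalar k U W u
        (fun t => fill k U W u.π₁₃.pairs φ (t.1.1, t.1.2.2)) = 1 := by
      refine finprod_eq_one_of_forall_eq_one fun t => ?_
      obtain ⟨⟨x, y, z⟩, ht⟩ := t
      by_cases h : x = none ∧ z = none
      · obtain ⟨rfl, rfl⟩ := h
        rw [orphanTerm_none]
        exact (congrArg _ (fill_none k U W _ φ)).trans (scalar_idUnit k U W)
      · exact orphanTerm_of_not k U W (x, y, z) h _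
    rw [h1, one_smul]
    exact congrArg _ (funext fun p => fill_mem k U W _ φ p)

/-- An adapted pair of sequences identifies `H_r(U; W)` with a space of morphisms in the tensor
power: nothing is lost by inserting identities of `𝟙`, since `End 𝟙 = k`. -/
theorem brEntry_injective (U : I → C) (W : K → C) (r : Rec₂ I K) (x : Seq I d) (z : Seq K d)
    (h : Adapted (fun a => (x.val a, z.val a)) r) :
    Function.Injective (brEntry k d U W r x z) := by
  -- With a middle sequence meeting every place, the triples of `u` are indexed by the places.
  obtain ⟨y, hy⟩ := Seq.exists_pos_eq (d := d) id Function.injective_id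
  obtain ⟨u, hu⟩ := exists_realized x y z
  obtain rfl : r = u.π₁₃ := Rec₂.eq_of_adapted h (adapted₁₃ hu)
  have hpos (a : Fin d) : pos₃ x y z (.inr (.inl a)) = a := congrFun hy a
  let f (a : Fin d) : u.triples := ⟨(x.val a, y.val a, z.val a), (mem_triples_iff hu _).2
    ⟨.inr (.inl a), by rw [hpos]⟩⟩
  have hf : Function.Bijective f := by
    constructor
    · intro a b hab
      have ha := (mem_block₃_iff x y z a (.inr (.inl a))).2 (hpos a)
      have hab : (x.val a, y.val a, z.val a) = (x.val b, y.val b, z.val b) :=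
        congrArg Subtype.val hab
      rw [hab, mem_block₃_iff, hpos] at ha
      exact ha
    · rintro ⟨t, ht⟩
      obtain ⟨e, rfl⟩ := (mem_triples_iff hu _).1 ht
      exact ⟨_, rfl⟩
  let E : u.triples ≃ Fin d := (Equiv.ofBijective f hf).symm
  let R := PiTensorProduct.reindex k
    (fun t : u.triples => (obj k U t.1.1 ⟶ obj k W t.1.2.2)) E
  have key (Φ : HRec k U W u.π₁₃) : brEntry k d U W u.π₁₃ x z Φ =
      R (spread k U W u.π₁₃.pairs (fun t : u.triples => (t.1.1, t.1.2.2))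
        (existsUnique₁₃ u) Φ) := by
    induction Φ using PiTensorProduct.induction_on with
    | add Φ Φ' h1 h2 => rw [map_add, map_add, map_add, h1, h2]; rfl
    | smul_tprod c φ =>
      rw [map_smul, map_smul, map_smul, spread_tprod, brEntry_of_adapted k d U W _ x z h]
      refine congrArg (c • ·) (Eq.trans ?_ (PiTensorProduct.reindex_tprod (R := k)
        (s := fun t : u.triples => (obj k U t.1.1 ⟶ obj k W t.1.2.2)) E
        fun t => fill k U W u.π₁₃.pairs φ (t.1.1, t.1.2.2)).symm)
      rfl
  intro Φ Φ' hΦ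
  rw [key, key] at hΦ
  rw [← contract_spread k U W u Φ, R.injective hΦ, contract_spread]

/-- Elements of `H(U; W)` in single summands are equal if they have the same entry at a pair of
sequences adapted to both of these summands. -/
theorem incl_eq_of_brEntry_eq (U : I → C) (W : K → C) {r r' : Rec₂ I K} {x : Seq I d}
    {z : Seq K d} (h : Adapted (fun a => (x.val a, z.val a)) r)
    (h' : Adapted (fun a => (x.val a, z.val a)) r') {Φ : HRec k U W r} {Φ' : HRec k U W r'}
    (heq : brEntry k d U W r x z Φ = brEntry k d U W r' x z Φ') :
    incl k U W r Φ = incl k U W r' Φ' := by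
  obtain rfl : r = r' := Rec₂.eq_of_adapted h h'
  rw [brEntry_injective k U W r x z h heq]

end Entries

/-! ### Composition in the wreath product -/

section WreathProduct

variable (k : Type w) [CommRing k] {C : Type u} [Category.{v} C] [Preadditive C]
  [Linear k C] [LinearWithUnit k C] {I J K : Type} (d : ℕ) [Finite I] [Finite J] [Finite K]

/-- The matrix entries of a morphism `⟨U⟩_d ⟶ ⟨V⟩_d`. -/
def entry (U : I → C) (V : J → C) (x : Seq I d) (y : Seq J d) :
    (brObj k d U ⟶ brObj k d V) →ₗ[k] ((⟨fun a => obj k U (x.val a)⟩ : TPow k C d) ⟶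
      ⟨fun a => obj k V (y.val a)⟩) where
  toFun f := f.1.f x y
  map_add' _ _ := rfl
  map_smul' _ _ := rfl

theorem hom_ext_entry {U : I → C} {V : J → C} {f g : brObj k d U ⟶ brObj k d V}
    (h : ∀ x y, entry k d U V x y f = entry k d U V x y g) : f = g := by
  apply Subtype.ext
  apply Idempotents.Karoubi.hom_ext
  apply Mat_.hom_ext
  exact h

theorem entry_comp (U : I → C) (V : J → C) (W : K → C) (f : brObj k d U ⟶ brObj k d V)
    (g : brObj k d V ⟶ brObj k d W) (x : Seq I d) (z : Seq K d) :
    entry k d U W x z (f ≫ g) = ∑ y : Seq J d, entry k d U V x y f ≫ entry k d V W y z g :=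
  Mat_.comp_apply (M := brMat k d U) (N := brMat k d V) (K := brMat k d W) f.1.f g.1.f x z

theorem entry_brHom_incl (U : I → C) (V : J → C) (r : Rec₂ I J) (Φ : HRec k U V r)
    (x : Seq I d) (y : Seq J d) :
    entry k d U V x y (brHom k d U V (incl k U V r Φ)) = brEntry k d U V r x y Φ := by
  classical
  rw [brHom, incl, DirectSum.toModule_lof]
  rfl

open Classical in
/-- The entry at `(x, z)` of the term of `u` collects the products of entries along the `P_u(d)`
middle sequences `y` for which `(x, y, z)` realizes `u`. -/
theorem poly_smul_brEntry_compGlue (U : I → C) (V : J → C) (W : K → C) {r : Rec₂ I J}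
    {s : Rec₂ J K} (u : Gluing r s) (x : Seq I d) (z : Seq K d) (Φ : HRec k U V r)
    (Ψ : HRec k V W s) :
    (u.1.poly k).eval (d : k) • brEntry k d U W u.1.π₁₃ x z (compGlue k U V W u Φ Ψ) =
      ∑ y : Seq J d, if Setoid.ker (pos₃ x y z) = u.1.rel then
        brEntry k d U V r x y Φ ≫ brEntry k d V W s y z Ψ else 0 := by
  have hterm : (∑ y : Seq J d, if Setoid.ker (pos₃ x y z) = u.1.rel then
        brEntry k d U V r x y Φ ≫ brEntry k d V W s y z Ψ else 0) =
      ∑ y : Seq J d, if Setoid.ker (pos₃ x y z) = u.1.rel then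
        brEntry k d U W u.1.π₁₃ x z (compGlue k U V W u Φ Ψ) else 0 := by
    refine Finset.sum_congr rfl fun y _ => ?_
    split_ifs with h
    · exact (brEntry_compGlue k U V W u h Φ Ψ).symm
    · rfl
  rw [hterm, ← Finset.sum_filter, Finset.sum_const]
  by_cases h : Adapted (fun a => (x.val a, z.val a)) u.1.π₁₃
  · rw [← card_realizing k u.1 x z h, Nat.cast_smul_eq_nsmul, Nat.card_eq_fintype_card,
      Fintype.card_subtype]
  · rw [brEntry_of_not_adapted k d U W _ x z h, LinearMap.zero_apply, smul_zero, smul_zero]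

theorem brHom_comp_brHom (U : I → C) (V : J → C) (W : K → C) (r : Rec₂ I J) (s : Rec₂ J K)
    (Φ : HRec k U V r) (Ψ : HRec k V W s) :
    brHom k d U V (incl k U V r Φ) ≫ brHom k d V W (incl k V W s Ψ) =
      ∑ g : Gluing r s, (g.1.poly k).eval (d : k) •
        brHom k d U W (incl k U W g.1.π₁₃ (compGlue k U V W g Φ Ψ)) := by
  classical
  refine hom_ext_entry k d fun x z => ?_
  simp only [entry_comp, entry_brHom_incl, map_sum, map_smul, poly_smul_brEntry_compGlue]
  rw [Finset.sum_comm]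
  refine Finset.sum_congr rfl fun y _ => ?_
  -- For given `y`, the triple `(x, y, z)` realizes one gluing if it is adapted, and none otherwise.
  by_cases h : Adapted (fun a => (x.val a, y.val a)) r ∧ Adapted (fun a => (y.val a, z.val a)) s
  · obtain ⟨u, hu⟩ := exists_realized x y z
    let g : Gluing r s := ⟨u, Rec₂.eq_of_adapted (adapted₁₂ hu) h.1,
      Rec₂.eq_of_adapted (adapted₂₃ hu) h.2⟩
    rw [Fintype.sum_eq_single g, if_pos hu]
    exact fun g' hg' => if_neg fun h' => hg' (Subtype.ext (Rec₃.ext (h'.symm.trans hu)))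
  · have h0 : brEntry k d U V r x y Φ ≫ brEntry k d V W s y z Ψ = 0 := by
      rcases not_and_or.1 h with h | h
      · rw [brEntry_of_not_adapted k d U V r x y h, LinearMap.zero_apply, Limits.zero_comp]
      · rw [brEntry_of_not_adapted k d V W s y z h, LinearMap.zero_apply, Limits.comp_zero]
    rw [h0]
    simp

end WreathProduct

/-! ### Unit laws -/

section Identity

variable (k : Type w) [CommRing k] {C : Type u} [Category.{v} C] [Preadditive C]
  [Linear k C] [LinearWithUnit k C] {I J K : Type}

theorem HTot.induction {U : I → C} {V : J → C} {P : HTot k U V → Prop}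
    (incl : ∀ r Φ, P (incl k U V r Φ)) (zero : P 0) (add : ∀ Φ Φ', P Φ → P Φ' → P (Φ + Φ'))
    (Φ : HTot k U V) : P Φ := by
  classical
  induction Φ using DirectSum.induction_on with
  | zero => exact zero
  | of r Φ => exact incl r Φ
  | add Φ Φ' h h' => exact add Φ Φ' h h'

theorem exists_adapted [Finite I] [Finite J] (r : Rec₂ I J) :
    ∃ (d : ℕ) (x : Seq I d) (y : Seq J d), Adapted (fun a => (x.val a, y.val a)) r := by
  obtain ⟨f, hf⟩ := exists_ker_eq r.rel le_rfl
  obtain ⟨x, hx⟩ := Seq.exists_pos_eq (fun i => f (.inl i)) fun i i' h => r.inj₁ i i' (by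
    rw [← hf]; exact h)
  obtain ⟨y, hy⟩ := Seq.exists_pos_eq (fun j => f (.inr j)) fun j j' h => r.inj₂ j j' (by
    rw [← hf]; exact h)
  refine ⟨_, x, y, (adapted_iff ..).2 (Eq.trans (congrArg Setoid.ker (funext ?_)) hf)⟩
  rintro (i | j)
  exacts [congrFun hx i, congrFun hy j]

theorem adapted_diag {d : ℕ} (x : Seq I d) :
    Adapted (fun a => (x.val a, x.val a)) (Rec₂.diag I) := by
  refine (adapted_iff ..).2 (Setoid.ext fun e e' => ?_)
  change pos₂ x x e = pos₂ x x e' ↔ Sum.elim id id e = Sum.elim id id e'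
  rw [← x.pos_injective.eq_iff]
  rcases e with i | i <;> rcases e' with i' | i' <;> rfl

/-- At `(x, x)` the entry of the identity is the identity; at an empty place of `x` this is the
inserted identity of `𝟙`. -/
theorem brEntry_diag {d : ℕ} (U : I → C) (x : Seq I d) :
    brEntry k d U U (Rec₂.diag I) x x (PiTensorProduct.tprod k fun p =>
      eqToHom (congrArg (obj k U) (Rec₂.diag_pairs p))) = 𝟙 _ := by
  rw [brEntry_of_adapted k d U U _ x x (adapted_diag x)]
  refine congrArg (PiTensorProduct.tprod k) (funext fun a => ?_)
  rcases (adapted_diag x).2 a with h | h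
  · have h : x.val a = none := congrArg Prod.fst h
    change fill k U U _ _ (x.val a, x.val a) = 𝟙 (obj k U (x.val a))
    rw [h]
    exact fill_none k U U _ _
  · exact fill_mem k U U _ _ ⟨_, h⟩

/-- In a gluing, each middle `i` is forced into the class of the left `i`, so everything is pulled
back from `r`. -/
theorem subsingleton_gluing_diag_left (r : Rec₂ I J) : Subsingleton (Gluing (Rec₂.diag I) r) := by
  suffices h : ∀ u : Gluing (Rec₂.diag I) r, u.1.rel = r.rel.comap (Sum.elim .inl id) from
    ⟨fun u u' => Subtype.ext (Rec₃.ext ((h u).trans (h u').symm))⟩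
  rintro ⟨u, h12, h23⟩
  have hm (e : I ⊕ I ⊕ J) : u.rel e (.inr (Sum.elim .inl id e)) := by
    rcases e with i | e
    · have : u.π₁₂.rel (.inl i) (.inr i) := by rw [h12]; rfl
      exact this
    · exact u.rel.refl _
  refine Setoid.ext fun e e' => ?_
  have h := fun a b => iff_of_eq (congrArg (fun s => s.rel a b) h23)
  exact Iff.trans ⟨fun h => u.rel.trans (u.rel.symm (hm e)) (u.rel.trans h (hm e')),
    fun h => u.rel.trans (hm e) (u.rel.trans h (u.rel.symm (hm e')))⟩ (h _ _)

/-- In a gluing, each right `j` is forced into the class of the middle `j`, so everything is pulled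
back from `r`. -/
theorem subsingleton_gluing_diag_right (r : Rec₂ I J) : Subsingleton (Gluing r (Rec₂.diag J)) := by
  let m : I ⊕ J ⊕ J → I ⊕ J := Sum.map id (Sum.elim id id)
  suffices h : ∀ u : Gluing r (Rec₂.diag J), u.1.rel = r.rel.comap m from
    ⟨fun u u' => Subtype.ext (Rec₃.ext ((h u).trans (h u').symm))⟩
  rintro ⟨u, h12, h23⟩
  have hm (e : I ⊕ J ⊕ J) : u.rel e (Sum.map id .inl (m e)) := by
    rcases e with i | j | j
    · exact u.rel.refl _
    · exact u.rel.refl _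
    · have : u.π₂₃.rel (.inr j) (.inl j) := by rw [h23]; rfl
      exact this
  refine Setoid.ext fun e e' => ?_
  have h := fun a b => iff_of_eq (congrArg (fun s => s.rel a b) h12)
  exact Iff.trans ⟨fun h => u.rel.trans (u.rel.symm (hm e)) (u.rel.trans h (hm e')),
    fun h => u.rel.trans (hm e) (u.rel.trans h (u.rel.symm (hm e')))⟩ (h _ _)

variable [Finite I] [Finite J] [Finite K]

/-- If `r` and `s` have a single gluing, realized by `(x, y, z)`, and the places of `y` are among
those of `x` and `z`, then this gluing has no orphans, and composition reduces to one term with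
coefficient `1`. -/
theorem compTot_eq_of_unique (t : k) (U : I → C) (V : J → C) (W : K → C) {r : Rec₂ I J}
    {s : Rec₂ J K} {r' : Rec₂ I K} {d : ℕ} {x : Seq I d} {y : Seq J d} {z : Seq K d}
    (hr : Adapted (fun a => (x.val a, y.val a)) r) (hs : Adapted (fun a => (y.val a, z.val a)) s)
    (hr' : Adapted (fun a => (x.val a, z.val a)) r')
    (hrange : Set.range (pos₃ x y z) = Set.range (pos₂ x z)) (huniq : Subsingleton (Gluing r s))
    (Φ : HRec k U V r) (Ψ : HRec k V W s) (Θ : HRec k U W r')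
    (h : brEntry k d U V r x y Φ ≫ brEntry k d V W s y z Ψ = brEntry k d U W r' x z Θ) :
    compTot k t U V W (incl k U V r Φ) (incl k V W s Ψ) = incl k U W r' Θ := by
  obtain ⟨u, hu⟩ := exists_realized x y z
  let g : Gluing r s := ⟨u, Rec₂.eq_of_adapted (adapted₁₂ hu) hr,
    Rec₂.eq_of_adapted (adapted₂₃ hu) hs⟩
  have hpoly : u.poly k = 1 := by
    have h13 := (adapted_iff ..).1 (adapted₁₃ hu)
    rw [Rec₃.poly, length₂_eq, length₃_eq, ← hu, ← h13, card_quotient_ker, card_quotient_ker,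
      hrange, Finset.Ico_self, Finset.prod_empty]
  rw [compTot_incl, Fintype.sum_subsingleton _ g]
  change (u.poly k).eval t • _ = _
  rw [hpoly, Polynomial.eval_one, one_smul]
  refine incl_eq_of_brEntry_eq k U W (adapted₁₃ hu) hr' ?_
  rw [← h]
  exact brEntry_compGlue k U V W g hu Φ Ψ

theorem idTot_compTot (t : k) (U : I → C) (V : J → C) (Φ : HTot k U V) :
    compTot k t U U V (idTot k U) Φ = Φ := by
  induction Φ using HTot.induction with
  | zero => exact map_zero _
  | add Φ Φ' h h' => rw [map_add, h, h']
  | incl r Φ =>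
    obtain ⟨d, x, y, h⟩ := exists_adapted r
    -- The only gluing is realized by `(x, x, y)`.
    refine compTot_eq_of_unique k t U U V (adapted_diag x) h h ?_
      (subsingleton_gluing_diag_left r) _ Φ Φ ?_
    · simp [pos₃, pos₂, Set.Sum.elim_range]
    · rw [brEntry_diag, Category.id_comp]

theorem compTot_idTot (t : k) (U : I → C) (V : J → C) (Φ : HTot k U V) :
    compTot k t U V V Φ (idTot k V) = Φ := by
  induction Φ using HTot.induction with
  | zero => rw [map_zero, LinearMap.zero_apply]
  | add Φ Φ' h h' => rw [map_add, LinearMap.add_apply, h, h']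
  | incl r Φ =>
    obtain ⟨d, x, y, h⟩ := exists_adapted r
    -- The only gluing is realized by `(x, y, y)`.
    refine compTot_eq_of_unique k t U V V h (adapted_diag y) h ?_
      (subsingleton_gluing_diag_right r) Φ _ Φ ?_
    · simp [pos₃, pos₂, Set.Sum.elim_range]
    · rw [brEntry_diag, Category.comp_id]

end Identity

/-! ### Associativity -/

section Associativity

variable {I J K L : Type} {d : ℕ}

/-- The map sending each point of `I ⊔ J ⊔ K ⊔ L` to its place in a quadruple of sequences. -/
noncomputable def pos₄ (x : Seq I d) (y : Seq J d) (z : Seq K d) (l : Seq L d) :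
    I ⊕ J ⊕ K ⊕ L → Fin d :=
  Sum.elim x.pos (Sum.elim y.pos (Sum.elim z.pos l.pos))

theorem exists_ker_pos₄_eq [Finite I] [Finite J] [Finite K] [Finite L]
    (w : Setoid (I ⊕ J ⊕ K ⊕ L)) (h₁ : ∀ i i', w (.inl i) (.inl i') → i = i')
    (h₂ : ∀ j j', w (.inr (.inl j)) (.inr (.inl j')) → j = j')
    (h₃ : ∀ m m', w (.inr (.inr (.inl m))) (.inr (.inr (.inl m'))) → m = m')
    (h₄ : ∀ l l', w (.inr (.inr (.inr l))) (.inr (.inr (.inr l'))) → l = l') :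
    ∃ (d : ℕ) (x : Seq I d) (y : Seq J d) (z : Seq K d) (l : Seq L d),
      w = Setoid.ker (pos₄ x y z l) := by
  obtain ⟨d, f, rfl⟩ : ∃ (d : ℕ) (f : _ → Fin d), Setoid.ker f = w :=
    ⟨_, exists_ker_eq w le_rfl⟩
  obtain ⟨x, hx⟩ := Seq.exists_pos_eq (fun i => f (.inl i)) fun i i' h => h₁ i i' h
  obtain ⟨y, hy⟩ := Seq.exists_pos_eq (fun j => f (.inr (.inl j))) fun j j' h => h₂ j j' h
  obtain ⟨z, hz⟩ := Seq.exists_pos_eq (fun m => f (.inr (.inr (.inl m)))) fun m m' h => h₃ m m' h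
  obtain ⟨l, hl⟩ := Seq.exists_pos_eq (fun l => f (.inr (.inr (.inr l)))) fun l l' h => h₄ l l' h
  refine ⟨_, x, y, z, l, congrArg Setoid.ker (funext ?_)⟩
  rintro (i | j | m | l)
  exacts [(congrFun hx i).symm, (congrFun hy j).symm, (congrFun hz m).symm, (congrFun hl l).symm]

/-- The partition `w` of `I ⊔ J ⊔ K ⊔ L` restricts to `u` on `I ⊔ J ⊔ K` and to `v` on
`I ⊔ K ⊔ L`. -/
def IsOver (w : Setoid (I ⊕ J ⊕ K ⊕ L)) (u : Rec₃ I J K) (v : Rec₃ I K L) : Prop :=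
  w.comap (Sum.map id Sum.inr) = v.rel ∧ w.comap (Sum.map id (Sum.map id Sum.inl)) = u.rel

/-- The partition `w` of `I ⊔ J ⊔ K ⊔ L` restricts to `u` on `J ⊔ K ⊔ L` and to `v` on
`I ⊔ J ⊔ L`. -/
def IsOver' (w : Setoid (I ⊕ J ⊕ K ⊕ L)) (u : Rec₃ J K L) (v : Rec₃ I J L) : Prop :=
  w.comap (Sum.map id (Sum.map id Sum.inr)) = v.rel ∧ w.comap Sum.inr = u.rel

theorem isOver_ker_iff (x : Seq I d) (y : Seq J d) (z : Seq K d) (l : Seq L d) (u : Rec₃ I J K)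
    (v : Rec₃ I K L) : IsOver (Setoid.ker (pos₄ x y z l)) u v ↔
      Setoid.ker (pos₃ x z l) = v.rel ∧ Setoid.ker (pos₃ x y z) = u.rel := by
  have h₁ : pos₄ x y z l ∘ Sum.map id Sum.inr = pos₃ x z l := by
    funext e; rcases e with _ | _ | _ <;> rfl
  have h₂ : pos₄ x y z l ∘ Sum.map id (Sum.map id Sum.inl) = pos₃ x y z := by
    funext e; rcases e with _ | _ | _ <;> rfl
  rw [← h₁, ← h₂]
  rfl

theorem isOver'_ker_iff (x : Seq I d) (y : Seq J d) (z : Seq K d) (l : Seq L d) (u : Rec₃ J K L)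
    (v : Rec₃ I J L) : IsOver' (Setoid.ker (pos₄ x y z l)) u v ↔
      Setoid.ker (pos₃ x y l) = v.rel ∧ Setoid.ker (pos₃ y z l) = u.rel := by
  have h₁ : pos₄ x y z l ∘ Sum.map id (Sum.map id Sum.inr) = pos₃ x y l := by
    funext e; rcases e with _ | _ | _ <;> rfl
  have h₂ : pos₄ x y z l ∘ Sum.inr = pos₃ y z l := by
    funext e; rcases e with _ | _ | _ <;> rfl
  rw [← h₁, ← h₂]
  rfl

/-- Successive gluings `u ∈ R(s ∘ r)` and `v ∈ R(q ∘ π₁₃ u)`, which index the terms of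
`Θ ∘ (Ψ ∘ Φ)`. -/
abbrev Gluing₂ (r : Rec₂ I J) (s : Rec₂ J K) (q : Rec₂ K L) : Type :=
  Σ u : Gluing r s, Gluing u.1.π₁₃ q

/-- Successive gluings `u ∈ R(q ∘ s)` and `v ∈ R(π₁₃ u ∘ r)`, which index the terms of
`(Θ ∘ Ψ) ∘ Φ`. -/
abbrev Gluing₂' (r : Rec₂ I J) (s : Rec₂ J K) (q : Rec₂ K L) : Type :=
  Σ u : Gluing s q, Gluing r u.1.π₁₃

theorem Gluing₂.ext_isOver {r : Rec₂ I J} {s : Rec₂ J K} {q : Rec₂ K L} {p p' : Gluing₂ r s q}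
    {w : Setoid (I ⊕ J ⊕ K ⊕ L)} (h : IsOver w p.1.1 p.2.1) (h' : IsOver w p'.1.1 p'.2.1) :
    p = p' := by
  obtain ⟨⟨u, hu⟩, v, hv⟩ := p
  obtain ⟨⟨u', hu'⟩, v', hv'⟩ := p'
  obtain rfl : u = u' := Rec₃.ext (h.2.symm.trans h'.2)
  obtain rfl : v = v' := Rec₃.ext (h.1.symm.trans h'.1)
  rfl

theorem Gluing₂'.ext_isOver' {r : Rec₂ I J} {s : Rec₂ J K} {q : Rec₂ K L}
    {p p' : Gluing₂' r s q} {w : Setoid (I ⊕ J ⊕ K ⊕ L)} (h : IsOver' w p.1.1 p.2.1)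
    (h' : IsOver' w p'.1.1 p'.2.1) : p = p' := by
  obtain ⟨⟨u, hu⟩, v, hv⟩ := p
  obtain ⟨⟨u', hu'⟩, v', hv'⟩ := p'
  obtain rfl : u = u' := Rec₃.ext (h.2.symm.trans h'.2)
  obtain rfl : v = v' := Rec₃.ext (h.1.symm.trans h'.1)
  rfl

section

variable [Finite I] [Finite J] [Finite K] [Finite L] {r : Rec₂ I J} {s : Rec₂ J K} {q : Rec₂ K L}

theorem IsOver.exists_realization {w : Setoid (I ⊕ J ⊕ K ⊕ L)} {u : Rec₃ I J K} {v : Rec₃ I K L}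
    (h : IsOver w u v) : ∃ (d : ℕ) (x : Seq I d) (y : Seq J d) (z : Seq K d) (l : Seq L d),
      w = Setoid.ker (pos₄ x y z l) := by
  refine exists_ker_pos₄_eq w (fun i i' hw => u.inj₁ i i' ?_) (fun i i' hw => u.inj₂ i i' ?_)
    (fun i i' hw => u.inj₃ i i' ?_) (fun i i' hw => v.inj₃ i i' ?_)
  · rw [← h.2]; exact hw
  · rw [← h.2]; exact hw
  · rw [← h.2]; exact hw
  · rw [← h.1]; exact hw

theorem IsOver'.exists_realization {w : Setoid (I ⊕ J ⊕ K ⊕ L)} {u : Rec₃ J K L}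
    {v : Rec₃ I J L} (h : IsOver' w u v) :
    ∃ (d : ℕ) (x : Seq I d) (y : Seq J d) (z : Seq K d) (l : Seq L d),
      w = Setoid.ker (pos₄ x y z l) := by
  refine exists_ker_pos₄_eq w (fun i i' hw => v.inj₁ i i' ?_) (fun i i' hw => u.inj₁ i i' ?_)
    (fun i i' hw => u.inj₂ i i' ?_) (fun i i' hw => u.inj₃ i i' ?_)
  · rw [← h.1]; exact hw
  · rw [← h.2]; exact hw
  · rw [← h.2]; exact hw
  · rw [← h.2]; exact hw

theorem IsOver.exists_isOver' {w : Setoid (I ⊕ J ⊕ K ⊕ L)} {p : Gluing₂ r s q}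
    (h : IsOver w p.1.1 p.2.1) : ∃ p' : Gluing₂' r s q, IsOver' w p'.1.1 p'.2.1 := by
  obtain ⟨⟨u, hu⟩, v, hv⟩ := p
  obtain ⟨d, x, y, z, l, rfl⟩ := h.exists_realization
  obtain ⟨hv', hu'⟩ := (isOver_ker_iff ..).1 h
  obtain ⟨u₁, hu₁⟩ := exists_realized y z l
  obtain ⟨v₁, hv₁⟩ := exists_realized x y l
  refine ⟨⟨⟨u₁, ?_, ?_⟩, v₁, ?_, ?_⟩, (isOver'_ker_iff ..).2 ⟨hv₁, hu₁⟩⟩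
  · exact (Rec₂.eq_of_adapted (adapted₁₂ hu₁) (adapted₂₃ hu')).trans hu.2
  · exact (Rec₂.eq_of_adapted (adapted₂₃ hu₁) (adapted₂₃ hv')).trans hv.2
  · exact (Rec₂.eq_of_adapted (adapted₁₂ hv₁) (adapted₁₂ hu')).trans hu.1
  · exact Rec₂.eq_of_adapted (adapted₂₃ hv₁) (adapted₁₃ hu₁)

theorem IsOver'.exists_isOver {w : Setoid (I ⊕ J ⊕ K ⊕ L)} {p : Gluing₂' r s q}
    (h : IsOver' w p.1.1 p.2.1) : ∃ p' : Gluing₂ r s q, IsOver w p'.1.1 p'.2.1 := by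
  obtain ⟨⟨u, hu⟩, v, hv⟩ := p
  obtain ⟨d, x, y, z, l, rfl⟩ := h.exists_realization
  obtain ⟨hv', hu'⟩ := (isOver'_ker_iff ..).1 h
  obtain ⟨u₁, hu₁⟩ := exists_realized x y z
  obtain ⟨v₁, hv₁⟩ := exists_realized x z l
  refine ⟨⟨⟨u₁, ?_, ?_⟩, v₁, ?_, ?_⟩, (isOver_ker_iff ..).2 ⟨hv₁, hu₁⟩⟩
  · exact (Rec₂.eq_of_adapted (adapted₁₂ hu₁) (adapted₁₂ hv')).trans hv.1
  · exact (Rec₂.eq_of_adapted (adapted₂₃ hu₁) (adapted₁₂ hu')).trans hu.1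
  · exact Rec₂.eq_of_adapted (adapted₁₂ hv₁) (adapted₁₃ hu₁)
  · exact (Rec₂.eq_of_adapted (adapted₂₃ hv₁) (adapted₂₃ hu')).trans hu.2

end

variable (k : Type w) [CommRing k] [Finite I] [Finite J] [Finite K] [Finite L]

noncomputable instance : Fintype (Setoid (I ⊕ J ⊕ K ⊕ L)) :=
  @Fintype.ofFinite _ (Finite.of_injective (fun w : Setoid (I ⊕ J ⊕ K ⊕ L) => fun a b => w a b)
    fun _ _ h => Setoid.ext fun a b => iff_of_eq (congrFun (congrFun h a) b))

open Classical in
/-- `P_u P_v` is the sum of the `P_w` over the `w` above `u` and `v`, for `u` on `I ⊔ J ⊔ K` and `v`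
on `I ⊔ K ⊔ L`, where `P_w` comes from the inclusion of `I ⊔ L` in `I ⊔ J ⊔ K ⊔ L`. -/
theorem poly_mul_poly (t : k) {u : Rec₃ I J K} {v : Rec₃ I K L} (h : v.π₁₂ = u.π₁₃) :
    (u.poly k).eval t * (v.poly k).eval t =
      ∑ w : Setoid (I ⊕ J ⊕ K ⊕ L), if IsOver w u v then
        (fallPoly k (Sum.map id (Sum.inr ∘ Sum.inr)) w).eval t else 0 := by
  rw [poly_eq_fallPoly, poly_eq_fallPoly, ← Finset.sum_filter]
  refine (fallPoly_mul_fallPoly k (Sum.map id Sum.inr) (Sum.map id Sum.inl) (Sum.map id Sum.inr)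
    (Sum.map id Sum.inr) (Sum.map id (Sum.map id Sum.inl)) ?_ ?_ ?_ v.rel u.rel
    (congrArg Rec₂.rel h) t).trans (Finset.sum_congr
    (Finset.filter_congr fun _ _ => Iff.rfl) fun w _ => ?_)
  · funext e; rcases e with _ | _ <;> rfl
  · intro A f f' hff'
    refine ⟨Sum.elim (f ∘ .inl) (Sum.elim (f' ∘ .inr ∘ .inl) (f ∘ .inr)), ?_, ?_⟩
    · funext e; rcases e with _ | _ | _ <;> rfl
    · funext e
      rcases e with i | j | m
      exacts [congrFun hff' (.inl i), rfl, congrFun hff' (.inr m)]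
  · rintro (i | j | m | l)
    exacts [.inl ⟨.inl i, rfl⟩, .inr ⟨.inr (.inl j), rfl⟩, .inl ⟨.inr (.inl m), rfl⟩,
      .inl ⟨.inr (.inr l), rfl⟩]
  · congr 2
    funext e; rcases e with _ | _ <;> rfl

open Classical in
/-- The analogue of `poly_mul_poly` for `u` on `J ⊔ K ⊔ L` and `v` on `I ⊔ J ⊔ L`. -/
theorem poly_mul_poly' (t : k) {u : Rec₃ J K L} {v : Rec₃ I J L} (h : v.π₂₃ = u.π₁₃) :
    (u.poly k).eval t * (v.poly k).eval t =
      ∑ w : Setoid (I ⊕ J ⊕ K ⊕ L), if IsOver' w u v then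
        (fallPoly k (Sum.map id (Sum.inr ∘ Sum.inr)) w).eval t else 0 := by
  rw [poly_eq_fallPoly, poly_eq_fallPoly, ← Finset.sum_filter]
  refine (fallPoly_mul_fallPoly k (Sum.map id Sum.inr) Sum.inr (Sum.map id Sum.inr)
    (Sum.map id (Sum.map id Sum.inr)) Sum.inr ?_ ?_ ?_ v.rel u.rel
    (congrArg Rec₂.rel h) t).trans (Finset.sum_congr
    (Finset.filter_congr fun _ _ => Iff.rfl) fun w _ => ?_)
  · rfl
  · intro A f f' hff'
    refine ⟨Sum.elim (f ∘ .inl) f', ?_, rfl⟩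
    funext e
    rcases e with i | j | l
    exacts [rfl, (congrFun hff' (.inl j)).symm, (congrFun hff' (.inr l)).symm]
  · rintro (i | e)
    exacts [.inl ⟨.inl i, rfl⟩, .inr ⟨e, rfl⟩]
  · congr 2
    funext e; rcases e with _ | _ <;> rfl

variable {C : Type u} [Category.{v} C] [Preadditive C] [Linear k C] [LinearWithUnit k C]
  (U : I → C) (V : J → C) (W : K → C) (X : L → C) {r : Rec₂ I J} {s : Rec₂ J K} {q : Rec₂ K L}

/-- Both iterated compositions along a partition of `I ⊔ J ⊔ K ⊔ L` agree: in a realization, their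
entries are the two bracketings of a composite of three morphisms in the tensor power. -/
theorem incl_compGlue_compGlue {w : Setoid (I ⊕ J ⊕ K ⊕ L)} {p : Gluing₂ r s q}
    {p' : Gluing₂' r s q} (h : IsOver w p.1.1 p.2.1) (h' : IsOver' w p'.1.1 p'.2.1)
    (Φ : HRec k U V r) (Ψ : HRec k V W s) (Θ : HRec k W X q) :
    incl k U X _ (compGlue k U W X p.2 (compGlue k U V W p.1 Φ Ψ) Θ) =
      incl k U X _ (compGlue k U V X p'.2 Φ (compGlue k V W X p'.1 Ψ Θ)) := by
  obtain ⟨d, x, y, z, l, rfl⟩ := h.exists_realization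
  obtain ⟨h₁, h₂⟩ := (isOver_ker_iff ..).1 h
  obtain ⟨h₁', h₂'⟩ := (isOver'_ker_iff ..).1 h'
  refine incl_eq_of_brEntry_eq k U X (adapted₁₃ h₁) (adapted₁₃ h₁') ?_
  rw [brEntry_compGlue k U W X p.2 h₁, brEntry_compGlue k U V W p.1 h₂,
    brEntry_compGlue k U V X p'.2 h₁', brEntry_compGlue k V W X p'.1 h₂', Category.assoc]

theorem compTot_assoc_incl (t : k) (Φ : HRec k U V r) (Ψ : HRec k V W s) (Θ : HRec k W X q) :
    compTot k t U W X (compTot k t U V W (incl k U V r Φ) (incl k V W s Ψ)) (incl k W X q Θ) =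
      compTot k t U V X (incl k U V r Φ)
        (compTot k t V W X (incl k V W s Ψ) (incl k W X q Θ)) := by
  classical
  let P (w : Setoid (I ⊕ J ⊕ K ⊕ L)) : k :=
    (fallPoly k (Sum.map id (Sum.inr ∘ Sum.inr) : I ⊕ L → _) w).eval t
  let T (p : Gluing₂ r s q) : HTot k U X :=
    incl k U X _ (compGlue k U W X p.2 (compGlue k U V W p.1 Φ Ψ) Θ)
  let T' (p : Gluing₂' r s q) : HTot k U X :=
    incl k U X _ (compGlue k U V X p.2 Φ (compGlue k V W X p.1 Ψ Θ))
  have hl : compTot k t U W X (compTot k t U V W (incl k U V r Φ) (incl k V W s Ψ))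
      (incl k W X q Θ) = ∑ w, ∑ p : Gluing₂ r s q, if IsOver w p.1.1 p.2.1 then P w • T p else 0 :=
    calc
      _ = ∑ p : Gluing₂ r s q, ((p.1.1.poly k).eval t * (p.2.1.poly k).eval t) • T p := by
        rw [compTot_incl, map_sum, LinearMap.sum_apply, Fintype.sum_sigma]
        refine Finset.sum_congr rfl fun u _ => ?_
        rw [map_smul, LinearMap.smul_apply, compTot_incl, Finset.smul_sum]
        exact Finset.sum_congr rfl fun v _ => (mul_smul _ _ _).symm
      _ = _ := by
        rw [Finset.sum_comm]
        refine Finset.sum_congr rfl fun p _ => ?_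
        rw [poly_mul_poly k t p.2.2.1, Finset.sum_smul]
        exact Finset.sum_congr rfl fun w _ => by rw [ite_smul, zero_smul]
  have hr : compTot k t U V X (incl k U V r Φ)
      (compTot k t V W X (incl k V W s Ψ) (incl k W X q Θ)) =
      ∑ w, ∑ p : Gluing₂' r s q, if IsOver' w p.1.1 p.2.1 then P w • T' p else 0 :=
    calc
      _ = ∑ p : Gluing₂' r s q, ((p.1.1.poly k).eval t * (p.2.1.poly k).eval t) • T' p := by
        rw [compTot_incl, map_sum, Fintype.sum_sigma]
        refine Finset.sum_congr rfl fun u _ => ?_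
        rw [map_smul, compTot_incl, Finset.smul_sum]
        exact Finset.sum_congr rfl fun v _ => (mul_smul _ _ _).symm
      _ = _ := by
        rw [Finset.sum_comm]
        refine Finset.sum_congr rfl fun p _ => ?_
        rw [poly_mul_poly' k t p.2.2.2, Finset.sum_smul]
        exact Finset.sum_congr rfl fun w _ => by rw [ite_smul, zero_smul]
  rw [hl, hr]
  refine Finset.sum_congr rfl fun w _ => ?_
  by_cases h : ∃ p : Gluing₂ r s q, IsOver w p.1.1 p.2.1
  · obtain ⟨p, hp⟩ := h
    obtain ⟨p', hp'⟩ := hp.exists_isOver'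
    rw [Fintype.sum_eq_single p, Fintype.sum_eq_single p', if_pos hp, if_pos hp']
    · exact congrArg (P w • ·) (incl_compGlue_compGlue k U V W X hp hp' Φ Ψ Θ)
    · exact fun p₁ h₁ => if_neg fun h => h₁ (Gluing₂'.ext_isOver' h hp')
    · exact fun p₁ h₁ => if_neg fun h => h₁ (Gluing₂.ext_isOver h hp)
  · rw [Finset.sum_eq_zero fun p _ => if_neg fun hp => h ⟨p, hp⟩,
      Finset.sum_eq_zero fun p _ => if_neg fun hp => h hp.exists_isOver]

theorem compTot_assoc (t : k) (Φ : HTot k U V) (Ψ : HTot k V W) (Θ : HTot k W X) :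
    compTot k t U W X (compTot k t U V W Φ Ψ) Θ =
      compTot k t U V X Φ (compTot k t V W X Ψ Θ) := by
  induction Φ using HTot.induction with
  | zero => simp only [map_zero, LinearMap.zero_apply]
  | add Φ Φ' h h' => simp only [map_add, LinearMap.add_apply, h, h']
  | incl r Φ =>
    induction Ψ using HTot.induction with
    | zero => simp only [map_zero, LinearMap.zero_apply]
    | add Ψ Ψ' h h' => simp only [map_add, LinearMap.add_apply, h, h']
    | incl s Ψ =>
      induction Θ using HTot.induction with
      | zero => simp only [map_zero]
      | add Θ Θ' h h' => simp only [map_add, h, h']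
      | incl q Θ => exact compTot_assoc_incl k U V W X t Φ Ψ Θ

end Associativity

end WreathCat

open WreathCat
theorem mainTheorem5 {k : Type w} [CommRing k] {C : Type u} [Category.{v} C] [Preadditive C]
    [Linear k C] [LinearWithUnit k C] :
    (∀ (d : ℕ) {I J K : Type} [Finite I] [Finite J] [Finite K]
      (U : I → C) (V : J → C) (W : K → C) (r : Rec₂ I J) (s : Rec₂ J K)
      (Φ : HRec k U V r) (Ψ : HRec k V W s),
      brHom k d U V (incl k U V r Φ) ≫ brHom k d V W (incl k V W s Ψ) =
        ∑ g : Gluing r s, (g.1.poly k).eval (d : k) •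
          brHom k d U W (incl k U W g.1.π₁₃ (compGlue k U V W g Φ Ψ))) ∧
    (∀ t : k,
      (∀ (X Y : S₀ k C t) (Φ : X ⟶ Y), 𝟙 X ≫ Φ = Φ) ∧
      (∀ (X Y : S₀ k C t) (Φ : X ⟶ Y), Φ ≫ 𝟙 Y = Φ) ∧
      (∀ (X Y Z W : S₀ k C t) (Φ : X ⟶ Y) (Ψ : Y ⟶ Z) (Θ : Z ⟶ W),
        (Φ ≫ Ψ) ≫ Θ = Φ ≫ (Ψ ≫ Θ))) :=
  ⟨fun d _ _ _ _ _ _ U V W r s Φ Ψ => brHom_comp_brHom k d U V W r s Φ Ψ,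
    fun t => ⟨fun X Y Φ => idTot_compTot k t X.obj Y.obj Φ,
      fun X Y Φ => compTot_idTot k t X.obj Y.obj Φ,
      fun X Y Z W Φ Ψ Θ => compTot_assoc k X.obj Y.obj Z.obj W.obj t Φ Ψ Θ⟩⟩
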